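/- **Model.** The Parallel Semi-Asymmetric Model (PSAM) has an unbounded asymmetric large-memory and a symmetric small-memory, both shared by all threads and accessed at word granularity. Each thread is a sequential word RAM with $O(1)$ local registers that also has an atomic compare-and-swap and a binary fork instruction: two child threads start at the next instruction, and the parent is suspended until both have terminated. A computation starts with one root thread and ends when it terminates; the instructions of concurrently running threads may be interleaved arbitrarily. Every instruction has unit cost, except that a write to the large-memory costs $\omega>1$. The *work* is the total cost of all instructions executed by all threads. The *depth* is the largest cost of a chain of dependent instructions (dependence through program order, forks and joins). The small-memory usage is the least number $k$ such that only the first $k$ words of the small-memory are accessed. A word has $w$ bits, where $2^w\ge c\,(n+m)$ for an absolute constant $c$. **Theorem.** There is a PSAM program for breadth-first search with the following property. Let $G$ be an undirected graph with vertices $0,\dots,n-1$ and $m$ edges, without self-edges or duplicate edges, where $m=\Omega(n)$, and let $d_G$ be its diameter, i.e. the largest distance between two vertices that are reachable from each other. Given a source vertex $s$ and $G$ in compressed sparse row format in the large-memory, the program terminates under every schedule and leaves in the small-memory the parent array of a breadth-first search tree of $G$ rooted at $s$: the parent of $s$ is $s$, the parent of every other vertex $v$ reachable from $s$ is a neighbour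 $u$ of $v$ with $\mathrm{dist}(s,v)=\mathrm{dist}(s,u)+1$, and unreachable vertices carry a special value (the largest machine word). It does so in $O(m)$ work and $O(d_G\log n)$ depth, and uses only $O(n)$ words of small-memory. The program and the constants do not depend on $\omega$, $w$, $G$ or $s$; only the constant in the work bound depends on the constant in the assumption $m=\Omega(n)$. -/

import Mathlib

/-!
The Parallel Semi-Asymmetric Model (PSAM): fork-join threads, each of them a sequential word RAM,
that share a symmetric small-memory and an asymmetric large-memory; and breadth-first search.
-/

namespace PSAM

/-- The two shared memories. -/
inductive Region where
  | small
  | large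

/-- Arithmetic operations and comparisons on machine words. -/
inductive BinOp where
  | add
  | sub
  | mul
  | div
  | eq
  | lt

/-- `w`-bit words are `BitVec w`: arithmetic is modulo `2 ^ w`, division and comparison are
unsigned, and a comparison yields `1` (true) or `0` (false). -/
def BinOp.eval {w : ℕ} : BinOp → BitVec w → BitVec w → BitVec w
  | .add, a, b => a + b
  | .sub, a, b => a - b
  | .mul, a, b => a * b
  | .div, a, b => a / b
  | .eq, a, b => if a = b then 1 else 0
  | .lt, a, b => if a.toNat < b.toNat then 1 else 0

/-- Instructions. The arguments `d a b e v : ℕ` are names of (thread-local) registers; a program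
text names finitely many registers, so a thread has `O(1)` of them. -/
inductive Instr where
  /-- `d := k` -/
  | const (d k : ℕ)
  /-- `d := f a b` -/
  | op (f : BinOp) (d a b : ℕ)
  /-- `d := M[a]` -/
  | load (M : Region) (d a : ℕ)
  /-- `M[a] := b` -/
  | store (M : Region) (a b : ℕ)
  /-- Atomic compare-and-swap: if `M[a] = e` then `M[a] := v` and `d := 1`, else `d := 0`. -/
  | cas (M : Region) (d a e v : ℕ)
  /-- Go to instruction number `target`. -/
  | jump (target : ℕ)
  /-- Go to instruction number `target` if register `a` holds `0`. -/
  | jumpZero (a target : ℕ)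
  /-- Create two child threads and suspend until both have terminated; see `exec`. -/
  | fork (d : ℕ)
  /-- Terminate this thread. -/
  | halt

/-- A program is a finite list of instructions, the same for all inputs and all word lengths. -/
abbrev Program := List Instr

/-- Every instruction has unit cost, except that writing to the large-memory costs `ω`. -/
def Instr.cost (ω : ℝ) : Instr → ℝ
  | .store .large _ _ => ω
  | .cas .large _ _ _ _ => ω
  | _ => 1

/-- The tree of threads created by a root thread.  The real number carried by a thread is the cost
of the most expensive chain of dependent instructions that led to its current state. -/
inductive Thread (w : ℕ) where
  /-- A thread about to execute instruction number `pc`. -/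
  | run (pc : ℕ) (regs : ℕ → BitVec w) (depth : ℝ)
  /-- A thread suspended by a fork; it will resume at `pc` with registers `regs`. -/
  | wait (pc : ℕ) (regs : ℕ → BitVec w) (left right : Thread w)
  /-- A terminated thread. -/
  | done (depth : ℝ)

/-- The contents of the shared memories, together with the cost counters: `work` is the total cost
of the instructions executed so far by all threads, and `space` is the least number `k` such that
all accesses to the small-memory so far went to its first `k` words. -/
structure Shared (w : ℕ) where
  small : BitVec w → BitVec w
  large : BitVec w → BitVec w
  work : ℝ
  space : ℕ

def Shared.read {w : ℕ} (σ : Shared w) : Region → BitVec w → BitVec w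
  | .small, a => σ.small a
  | .large, a => σ.large a

def Shared.write {w : ℕ} (σ : Shared w) : Region → BitVec w → BitVec w → Shared w
  | .small, a, x => { σ with small := Function.update σ.small a x }
  | .large, a, x => { σ with large := Function.update σ.large a x }

/-- Record that address `a` of a memory is accessed. -/
def Shared.touch {w : ℕ} (σ : Shared w) : Region → BitVec w → Shared w
  | .small, a => { σ with space := max σ.space (a.toNat + 1) }
  | .large, _ => σ

/-- Add `c` to the work. -/
def Shared.charge {w : ℕ} (σ : Shared w) (c : ℝ) : Shared w :=
  { σ with work := σ.work + c }

/-- The effect, on memories and registers, of executing one instruction in a thread with program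
counter `pc`, registers `R` and depth `t`.

At `fork d` two children start at the next instruction with copies of the registers of the parent,
except that `d` holds `1` in the first child and `2` in the second.  The parent is suspended, and
when both children have terminated it resumes at the next instruction with `d` holding `0`. -/
noncomputable def exec {w : ℕ} (ω : ℝ) (i : Instr) (pc : ℕ) (R : ℕ → BitVec w) (t : ℝ)
    (σ : Shared w) : Thread w × Shared w :=
  let t' := t + i.cost ω
  let σ' := σ.charge (i.cost ω)
  match i with
  | .const d k => (.run (pc + 1) (Function.update R d (BitVec.ofNat w k)) t', σ')
  | .op f d a b => (.run (pc + 1) (Function.update R d (f.eval (R a) (R b))) t', σ')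
  | .load M d a => (.run (pc + 1) (Function.update R d (σ.read M (R a))) t', σ'.touch M (R a))
  | .store M a b => (.run (pc + 1) R t', (σ'.touch M (R a)).write M (R a) (R b))
  | .cas M d a e v =>
      if σ.read M (R a) = R e then
        (.run (pc + 1) (Function.update R d 1) t', (σ'.touch M (R a)).write M (R a) (R v))
      else
        (.run (pc + 1) (Function.update R d 0) t', σ'.touch M (R a))
  | .jump l => (.run l R t', σ')
  | .jumpZero a l => (.run (if R a = 0 then l else pc + 1) R t', σ')
  | .fork d =>
      (.wait (pc + 1) (Function.update R d 0)
        (.run (pc + 1) (Function.update R d 1) t')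
        (.run (pc + 1) (Function.update R d 2) t'), σ')
  | .halt => (.done t', σ')

/-- One step of the asynchronous machine: any one of the running threads executes one instruction
atomically, or any suspended thread both of whose children have terminated is resumed. -/
inductive Step {w : ℕ} (ω : ℝ) (prog : Program) :
    Thread w × Shared w → Thread w × Shared w → Prop
  | exec {pc : ℕ} {R : ℕ → BitVec w} {t : ℝ} {σ : Shared w} {i : Instr}
      {c : Thread w × Shared w} (h : prog[pc]? = some i) (hc : exec ω i pc R t σ = c) :
      Step ω prog (.run pc R t, σ) c
  | left {pc : ℕ} {R : ℕ → BitVec w} {l l' r : Thread w} {σ σ' : Shared w}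
      (h : Step ω prog (l, σ) (l', σ')) :
      Step ω prog (.wait pc R l r, σ) (.wait pc R l' r, σ')
  | right {pc : ℕ} {R : ℕ → BitVec w} {l r r' : Thread w} {σ σ' : Shared w}
      (h : Step ω prog (r, σ) (r', σ')) :
      Step ω prog (.wait pc R l r, σ) (.wait pc R l r', σ')
  | join {pc : ℕ} {R : ℕ → BitVec w} {t₁ t₂ : ℝ} {σ : Shared w} :
      Step ω prog (.wait pc R (.done t₁) (.done t₂), σ) (.run pc R (max t₁ t₂), σ)

/-- Under every schedule, the execution from the given configuration terminates, without getting
stuck, with the root thread terminated, and the depth of the computation and the final state of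
the shared memories satisfy `Q`. -/
inductive Guarantees {w : ℕ} (ω : ℝ) (prog : Program) (Q : ℝ → Shared w → Prop) :
    Thread w × Shared w → Prop
  | done {t : ℝ} {σ : Shared w} (h : Q t σ) : Guarantees ω prog Q (.done t, σ)
  | step {c : Thread w × Shared w} (progress : ∃ c', Step ω prog c c')
      (h : ∀ c', Step ω prog c c' → Guarantees ω prog Q c') : Guarantees ω prog Q c

/-- The initial configuration: a single root thread at instruction `0`, with the input word `x` in
register `0` and `0` in all other registers; all cost counters are `0`. -/
def initial {w : ℕ} (x : BitVec w) (small large : BitVec w → BitVec w) :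
    Thread w × Shared w :=
  (.run 0 (Function.update (fun _ => 0) 0 x) 0,
    { small := small, large := large, work := 0, space := 0 })

/-- The number stored at address `i` of a memory. -/
def word {w : ℕ} (M : BitVec w → BitVec w) (i : ℕ) : ℕ := (M (BitVec.ofNat w i)).toNat

/-- The memory `M` holds the graph `G` in compressed sparse row format: word `0` is the number `n`
of vertices, words `1, …, n + 1` are the offsets, and the words from address `n + 2` on are the
concatenated adjacency lists, where the list of `v` occupies the positions from the `v`-th offset
(inclusive) to the `(v + 1)`-st (exclusive) and contains each neighbour of `v` once, in any order.
The remaining words are arbitrary. -/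
structure IsCSR {n w : ℕ} (G : SimpleGraph (Fin n)) (M : BitVec w → BitVec w) : Prop where
  size : word M 0 = n
  offset_zero : word M 1 = 0
  offset_mono : ∀ v : Fin n, word M (1 + v) ≤ word M (2 + v)
  adjacency : ∀ v : Fin n,
    Set.BijOn (fun j => word M (n + 2 + j)) (Set.Ico (word M (1 + v)) (word M (2 + v)))
      (Fin.val '' G.neighborSet v)

/-- The first `n` words of the memory `P` hold the parent array of a breadth-first search tree of
`G` rooted at `s`: the parent of `s` is `s` itself, the parent of any other vertex `v` that is
reachable from `s` is a neighbour of `v` at distance one less from `s`, and vertices that are not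
reachable from `s` carry the largest machine word. -/
structure IsBFSTree {n w : ℕ} (G : SimpleGraph (Fin n)) (s : Fin n) (P : BitVec w → BitVec w) :
    Prop where
  root : word P s = s
  parent : ∀ v : Fin n, v ≠ s → G.Reachable s v →
    ∃ u : Fin n, word P v = u ∧ G.Adj u v ∧ G.dist s v = G.dist s u + 1
  unreachable : ∀ v : Fin n, ¬ G.Reachable s v → P (BitVec.ofNat w v) = BitVec.allOnes w

/-- The number of edges. -/
noncomputable def edgeCount {n : ℕ} (G : SimpleGraph (Fin n)) : ℕ := G.edgeSet.ncard

/-- The diameter: the largest distance between two vertices that are reachable from each other.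
(`SimpleGraph.dist` is `0` for a pair of vertices that are not.) -/
noncomputable def diameter {n : ℕ} (G : SimpleGraph (Fin n)) : ℕ :=
  Finset.univ.sup fun p : Fin n × Fin n => G.dist p.1 p.2

end PSAM

/-! The search runs in rounds, one per level. No thread writes to the large-memory, so every
instruction costs 1 and work is a count of instructions. The small-memory holds the parent array,
two frontier arrays of `n` words that swap roles after each round, and a heap-ordered tree of fewer
than `2 * n` nodes, within `5 * n` words in all.

A round sums the degrees of the frontier bottom-up in a binary tree; let `D` be the total. If `D =
0`, no edge leaves the level and the search is complete. Otherwise the next frontier is an array of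
length `min D n`, cleared to holes. If `D ≤ n`, every edge leaving the frontier owns a slot, found
from prefix sums while descending the tree; if `D > n`, every vertex owns a slot. Each edge `(u, v)`
tries to set the parent of `v` by compare-and-swap, and the edge recorded there writes `v` into its
slot.

All loops are binary fork trees, at most two of them nested, so a round has depth `O(log n)`, and
there are at most `diameter G + 2` rounds. A round costs `O(len + D)`, where the length `len` of the
current frontier is 1 or at most the `D` of the round before. The values of `D` add up to at most `2
* m`; initialising the parents adds `O(n)`.

Arbitrary schedules are handled by rely-guarantee reasoning. `Safe` is a step-indexed specification:
its index bounds the remaining steps, and its postcondition survives permitted interference. In a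
parallel loop all threads respect one preorder on memories, so siblings compose (`Safe.wait`,
`Safe.fork`) and leaf specifications lift to whole loops (`Safe.tree`). When each address has only
one value to receive, the preorder is `WriteRel`; for the racing edges it is `Claim.Rel`, under
which a processed claim stays processed (`Claim.Rel.done`). `SearchState.next` deduces from the
processed claims that memory encodes the next level, whatever the winners. `safe_rounds` amortises
the cost, and `Safe.guarantees` returns to the machine. -/

namespace PSAM

/-! ### Rely-guarantee specifications of threads -/

/-- The contents of one of the memories. -/
abbrev Mem (w : ℕ) := BitVec w → BitVec w

/-- The values of the registers of a thread. -/
abbrev Regs (w : ℕ) := ℕ → BitVec w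

/-- A machine with a fixed program, a fixed (never written) large-memory, and a bound on the
small-memory that may be used. -/
structure Machine (w : ℕ) where
  ω : ℝ
  prog : Program
  large : Mem w
  space : ℕ

/-- The interference protocol of a thread: `rely` bounds what the other threads may do to the
small-memory, `guar` bounds what a single step of the thread itself may do to it. -/
structure Protocol (w : ℕ) where
  rely : Mem w → Mem w → Prop
  guar : Mem w → Mem w → Prop
  rely_refl : ∀ m, rely m m
  rely_trans : ∀ {a b c}, rely a b → rely b c → rely a c
  guar_refl : ∀ m, guar m m

/-- The protocol of a thread that runs alone. -/
def Protocol.alone (w : ℕ) : Protocol w where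
  rely := Eq
  guar _ _ := True
  rely_refl _ := rfl
  rely_trans := Eq.trans
  guar_refl _ := trivial

/-- The protocol of threads all of whose steps respect one and the same preorder. -/
def Protocol.uniform {w : ℕ} (r : Mem w → Mem w → Prop) (h₁ : ∀ m, r m m)
    (h₂ : ∀ {a b c}, r a b → r b c → r a c) : Protocol w where
  rely := r
  guar := r
  rely_refl := h₁
  rely_trans := h₂
  guar_refl := h₁

section Safe

variable {w : ℕ} (M : Machine w) (p : Protocol w)

/-- Under interference that respects `p`, the thread `th` terminates in a state that satisfies `Q`
after at most `b` steps, each of unit cost at most, and respects `p` and the space bound. -/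
def Safe (Q : ℝ → Mem w → Prop) : ℕ → Thread w → Mem w → Prop
  | 0, th, m => ∀ m', p.rely m m' → ∃ t, th = .done t ∧ Q t m'
  | b + 1, th, m => ∀ m', p.rely m m' → (∃ t, th = .done t ∧ Q t m') ∨
      -- The counters are arbitrary here because they influence no instruction and siblings change
      -- them; only their increase is constrained.
      ∀ wk sp, sp ≤ M.space → (∃ c, Step M.ω M.prog (th, ⟨m', M.large, wk, sp⟩) c) ∧
        ∀ th' σ', Step M.ω M.prog (th, ⟨m', M.large, wk, sp⟩) (th', σ') →
          σ'.large = M.large ∧ σ'.work ≤ wk + 1 ∧ σ'.space ≤ M.space ∧ p.guar m' σ'.small ∧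
            Safe Q b th' σ'.small

variable {M p} {Q : ℝ → Mem w → Prop} {b : ℕ} {th : Thread w} {m : Mem w}

theorem Safe.of_rely (h : Safe M p Q b th m) {m' : Mem w} (hm : p.rely m m') :
    Safe M p Q b th m' := by
  cases b with
  | zero => exact fun m'' h'' => h m'' (p.rely_trans hm h'')
  | succ b => exact fun m'' h'' => h m'' (p.rely_trans hm h'')

theorem Safe.succ (h : Safe M p Q b th m) : Safe M p Q (b + 1) th m := by
  induction b generalizing th m with
  | zero => exact fun m' hm => .inl (h m' hm)
  | succ b ih =>
    intro m' hm
    refine (h m' hm).imp id fun h' wk sp hsp => ⟨(h' wk sp hsp).1, fun th' σ' hs => ?_⟩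
    obtain ⟨h1, h2, h3, h4, h5⟩ := (h' wk sp hsp).2 th' σ' hs
    exact ⟨h1, h2, h3, h4, ih h5⟩

theorem Safe.mono (h : Safe M p Q b th m) {b' : ℕ} (hb : b ≤ b') : Safe M p Q b' th m := by
  induction hb with
  | refl => exact h
  | step _ ih => exact ih.succ

theorem Safe.weaken {Q' : ℝ → Mem w → Prop} (h : Safe M p Q b th m)
    (hQ : ∀ t m', Q t m' → Q' t m') : Safe M p Q' b th m := by
  induction b generalizing th m with
  | zero =>
    intro m' hm
    obtain ⟨t, ht, hq⟩ := h m' hm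
    exact ⟨t, ht, hQ t m' hq⟩
  | succ b ih =>
    intro m' hm
    refine (h m' hm).imp (fun ⟨t, ht, hq⟩ => ⟨t, ht, hQ t m' hq⟩)
      fun h' wk sp hsp => ⟨(h' wk sp hsp).1, fun th' σ' hs => ?_⟩
    obtain ⟨h1, h2, h3, h4, h5⟩ := (h' wk sp hsp).2 th' σ' hs
    exact ⟨h1, h2, h3, h4, ih h5⟩

theorem Guarantees.mono {ω : ℝ} {prog : Program} {P P' : ℝ → Shared w → Prop}
    {c : Thread w × Shared w} (hP : ∀ t σ, P t σ → P' t σ) (hc : Guarantees ω prog P c) :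
    Guarantees ω prog P' c := by
  induction hc with
  | done h => exact .done (hP _ _ h)
  | step hp _ ih => exact .step hp ih

/-- A thread that is safe when run alone meets its postcondition under every schedule. -/
theorem Safe.guarantees (h : Safe M (.alone w) Q b th m) {wk : ℝ} {sp : ℕ} (hsp : sp ≤ M.space) :
    Guarantees M.ω M.prog (fun t σ => Q t σ.small ∧ σ.work ≤ wk + b ∧ σ.space ≤ M.space)
      (th, ⟨m, M.large, wk, sp⟩) := by
  induction b generalizing th m wk sp with
  | zero =>
    obtain ⟨t, rfl, hq⟩ := h m rfl
    exact .done ⟨hq, by simp, hsp⟩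
  | succ b ih =>
    rcases h m rfl with ⟨t, rfl, hq⟩ | h'
    · exact .done ⟨hq, by simp only; linarith [(b + 1).cast_nonneg (α := ℝ)], hsp⟩
    · obtain ⟨hp, hs⟩ := h' wk sp hsp
      refine .step hp ?_
      rintro ⟨th', m', l', wk', sp'⟩ hst
      obtain ⟨rfl, h2, h3, -, h5⟩ := hs _ _ hst
      simp only at h2 h3 h5
      refine (ih h5 (wk := wk') h3).mono fun t σ hσ => ⟨hσ.1, ?_, hσ.2.2⟩
      push_cast
      linarith [hσ.2.1]

/-! ### Rules for single instructions, fork and join -/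

section Instructions

variable {pc : ℕ} {R : Regs w} {t : ℝ}

theorem Safe.exec {i : Instr} (h : M.prog[pc]? = some i)
    (hs : ∀ m', p.rely m m' → ∀ wk sp, sp ≤ M.space →
      (exec M.ω i pc R t ⟨m', M.large, wk, sp⟩).2.large = M.large ∧
      (exec M.ω i pc R t ⟨m', M.large, wk, sp⟩).2.work ≤ wk + 1 ∧
      (exec M.ω i pc R t ⟨m', M.large, wk, sp⟩).2.space ≤ M.space ∧
      p.guar m' (exec M.ω i pc R t ⟨m', M.large, wk, sp⟩).2.small ∧
      Safe M p Q b (exec M.ω i pc R t ⟨m', M.large, wk, sp⟩).1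
        (exec M.ω i pc R t ⟨m', M.large, wk, sp⟩).2.small) :
    Safe M p Q (b + 1) (.run pc R t) m := by
  refine fun m' hm => .inr fun wk sp hsp => ⟨⟨_, .exec h rfl⟩, fun th' σ' hst => ?_⟩
  have key := hs m' hm wk sp hsp
  cases hst with
  | exec h' hc =>
    rw [h] at h'
    cases h'
    rw [hc] at key
    exact key

theorem Safe.const {d k : ℕ} (h : M.prog[pc]? = some (.const d k))
    (hs : Safe M p Q b (.run (pc + 1) (Function.update R d (BitVec.ofNat w k)) (t + 1)) m) :
    Safe M p Q (b + 1) (.run pc R t) m :=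
  .exec h fun m' hm _ _ hsp => ⟨rfl, le_rfl, hsp, p.guar_refl m', hs.of_rely hm⟩

theorem Safe.op {f : BinOp} {d x y : ℕ} (h : M.prog[pc]? = some (.op f d x y))
    (hs : Safe M p Q b (.run (pc + 1) (Function.update R d (f.eval (R x) (R y))) (t + 1)) m) :
    Safe M p Q (b + 1) (.run pc R t) m :=
  .exec h fun m' hm _ _ hsp => ⟨rfl, le_rfl, hsp, p.guar_refl m', hs.of_rely hm⟩

theorem Safe.jump {l : ℕ} (h : M.prog[pc]? = some (.jump l))
    (hs : Safe M p Q b (.run l R (t + 1)) m) :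
    Safe M p Q (b + 1) (.run pc R t) m :=
  .exec h fun m' hm _ _ hsp => ⟨rfl, le_rfl, hsp, p.guar_refl m', hs.of_rely hm⟩

theorem Safe.jumpZero {x l : ℕ} (h : M.prog[pc]? = some (.jumpZero x l))
    (hs : Safe M p Q b (.run (if R x = 0 then l else pc + 1) R (t + 1)) m) :
    Safe M p Q (b + 1) (.run pc R t) m :=
  .exec h fun m' hm _ _ hsp => ⟨rfl, le_rfl, hsp, p.guar_refl m', hs.of_rely hm⟩

theorem Safe.jumpZero_taken {x l : ℕ} (h : M.prog[pc]? = some (.jumpZero x l)) (hx : R x = 0)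
    (hs : Safe M p Q b (.run l R (t + 1)) m) :
    Safe M p Q (b + 1) (.run pc R t) m :=
  .jumpZero h (by rwa [if_pos hx])

theorem Safe.jumpZero_not_taken {x l : ℕ} (h : M.prog[pc]? = some (.jumpZero x l)) (hx : R x ≠ 0)
    (hs : Safe M p Q b (.run (pc + 1) R (t + 1)) m) :
    Safe M p Q (b + 1) (.run pc R t) m :=
  .jumpZero h (by rwa [if_neg hx])

theorem Safe.loadLarge {d x : ℕ} (h : M.prog[pc]? = some (.load .large d x))
    (hs : Safe M p Q b (.run (pc + 1) (Function.update R d (M.large (R x))) (t + 1)) m) :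
    Safe M p Q (b + 1) (.run pc R t) m :=
  .exec h fun m' hm _ _ hsp => ⟨rfl, le_rfl, hsp, p.guar_refl m', hs.of_rely hm⟩

theorem Safe.loadSmall {d x : ℕ} (h : M.prog[pc]? = some (.load .small d x))
    (hx : (R x).toNat < M.space)
    (hs : ∀ m', p.rely m m' →
      Safe M p Q b (.run (pc + 1) (Function.update R d (m' (R x))) (t + 1)) m') :
    Safe M p Q (b + 1) (.run pc R t) m :=
  .exec h fun m' hm _ _ hsp => ⟨rfl, le_rfl, max_le hsp hx, p.guar_refl m', hs m' hm⟩

theorem Safe.storeSmall {x y : ℕ} (h : M.prog[pc]? = some (.store .small x y))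
    (hx : (R x).toNat < M.space)
    (hs : ∀ m', p.rely m m' → p.guar m' (Function.update m' (R x) (R y)) ∧
      Safe M p Q b (.run (pc + 1) R (t + 1)) (Function.update m' (R x) (R y))) :
    Safe M p Q (b + 1) (.run pc R t) m :=
  .exec h fun m' hm _ _ hsp => ⟨rfl, le_rfl, max_le hsp hx, hs m' hm⟩

theorem Safe.casSmall {d x e v : ℕ} (h : M.prog[pc]? = some (.cas .small d x e v))
    (hx : (R x).toNat < M.space)
    (hs : ∀ m', p.rely m m' → m' (R x) = R e →
      p.guar m' (Function.update m' (R x) (R v)) ∧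
      Safe M p Q b (.run (pc + 1) (Function.update R d 1) (t + 1))
        (Function.update m' (R x) (R v)))
    (hf : ∀ m', p.rely m m' → m' (R x) ≠ R e →
      Safe M p Q b (.run (pc + 1) (Function.update R d 0) (t + 1)) m') :
    Safe M p Q (b + 1) (.run pc R t) m := by
  refine .exec h fun m' hm wk sp hsp => ?_
  by_cases he : m' (R x) = R e
  · rw [show PSAM.exec M.ω (.cas .small d x e v) pc R t ⟨m', M.large, wk, sp⟩ = _ from if_pos he]
    exact ⟨rfl, le_rfl, max_le hsp hx, hs m' hm he⟩
  · rw [show PSAM.exec M.ω (.cas .small d x e v) pc R t ⟨m', M.large, wk, sp⟩ = _ from if_neg he]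
    exact ⟨rfl, le_rfl, max_le hsp hx, p.guar_refl m', hf m' hm he⟩

theorem Safe.halt (h : M.prog[pc]? = some .halt) (hs : ∀ m', p.rely m m' → Q (t + 1) m') :
    Safe M p Q (b + 1) (.run pc R t) m := by
  refine .exec h fun m' hm _ _ hsp => ⟨rfl, le_rfl, hsp, p.guar_refl m', ?_⟩
  have : Safe M p Q 0 (.done (t + 1)) m' := fun m'' h'' => ⟨_, rfl, hs _ (p.rely_trans hm h'')⟩
  exact this.mono (Nat.zero_le b)

variable {r : Mem w → Mem w → Prop} {h₁ : ∀ m, r m m} {h₂ : ∀ {a b c}, r a b → r b c → r a c}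
  {Q₁ Q₂ : ℝ → Mem w → Prop} {b₁ b₂ : ℕ}

/-- Induction on the total budget of the two children: any interleaved step spends one unit of one
child. Outside interference is also an `r`-step, so both children tolerate it. Since the children's
postconditions persist under `r`, both hold at the moment of the join, which takes the extra unit.
-/
theorem Safe.wait (hrely : ∀ a c, p.rely a c → r a c) (hguar : ∀ a c, r a c → p.guar a c)
    {left right : Thread w}
    (hl : Safe M (.uniform r h₁ h₂) Q₁ b₁ left m) (hr : Safe M (.uniform r h₁ h₂) Q₂ b₂ right m)
    (hj : ∀ t₁ t₂ m', r m m' → Q₁ t₁ m' → Q₂ t₂ m' →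
      Safe M p Q b (.run pc R (max t₁ t₂)) m') :
    Safe M p Q (b₁ + b₂ + b + 1) (.wait pc R left right) m := by
  induction hn : b₁ + b₂ generalizing b₁ b₂ left right m with
  | zero =>
    obtain ⟨rfl, rfl⟩ : b₁ = 0 ∧ b₂ = 0 := by omega
    obtain ⟨t₁, rfl, -⟩ := hl m (h₁ m)
    obtain ⟨t₂, rfl, -⟩ := hr m (h₁ m)
    intro m' hm
    refine .inr fun wk sp hsp => ⟨⟨_, .join⟩, fun th' σ' hst => ?_⟩
    cases hst with
    | left h => cases h
    | right h => cases h
    | join =>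
      obtain ⟨_, e₁, q₁⟩ := hl m' (hrely _ _ hm)
      obtain ⟨_, e₂, q₂⟩ := hr m' (hrely _ _ hm)
      cases e₁
      cases e₂
      exact ⟨rfl, by simp, hsp, p.guar_refl _,
        (hj _ _ _ (hrely _ _ hm) q₁ q₂).mono (by omega)⟩
  | succ k ih =>
    intro m' hm
    have hm' := hrely _ _ hm
    have hl' := hl.of_rely (p := .uniform r h₁ h₂) hm'
    have hr' := hr.of_rely (p := .uniform r h₁ h₂) hm'
    refine .inr fun wk sp hsp => ?_
    have stepL : ∀ th' σ', Step M.ω M.prog (left, ⟨m', M.large, wk, sp⟩) (th', σ') →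
        σ'.large = M.large ∧ σ'.work ≤ wk + 1 ∧ σ'.space ≤ M.space ∧ p.guar m' σ'.small ∧
          Safe M p Q (k + 1 + b) (.wait pc R th' right) σ'.small := by
      intro th' σ' hst
      cases b₁ with
      | zero => obtain ⟨_, rfl, -⟩ := hl' m' (h₁ _); cases hst
      | succ b₁ =>
        rcases hl' m' (h₁ _) with ⟨_, rfl, -⟩ | h
        · cases hst
        · obtain ⟨g1, g2, g3, g4, g5⟩ := (h wk sp hsp).2 th' σ' hst
          refine ⟨g1, g2, g3, hguar _ _ g4, ?_⟩
          -- To the right child, the step just made by the left one is permitted interference.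
          have := ih g5 (hr'.of_rely (p := .uniform r h₁ h₂) g4)
            (fun t₁ t₂ m'' hm'' => hj t₁ t₂ m'' (h₂ (h₂ hm' g4) hm'')) (by omega)
          exact this.mono (by omega)
    have stepR : ∀ th' σ', Step M.ω M.prog (right, ⟨m', M.large, wk, sp⟩) (th', σ') →
        σ'.large = M.large ∧ σ'.work ≤ wk + 1 ∧ σ'.space ≤ M.space ∧ p.guar m' σ'.small ∧
          Safe M p Q (k + 1 + b) (.wait pc R left th') σ'.small := by
      intro th' σ' hst
      cases b₂ with
      | zero => obtain ⟨_, rfl, -⟩ := hr' m' (h₁ _); cases hst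
      | succ b₂ =>
        rcases hr' m' (h₁ _) with ⟨_, rfl, -⟩ | h
        · cases hst
        · obtain ⟨g1, g2, g3, g4, g5⟩ := (h wk sp hsp).2 th' σ' hst
          refine ⟨g1, g2, g3, hguar _ _ g4, ?_⟩
          have := ih (hl'.of_rely (p := .uniform r h₁ h₂) g4) g5
            (fun t₁ t₂ m'' hm'' => hj t₁ t₂ m'' (h₂ (h₂ hm' g4) hm'')) (by omega)
          exact this.mono (by omega)
    have progL : (∃ t₁, left = .done t₁ ∧ Q₁ t₁ m') ∨
        ∃ c, Step M.ω M.prog (left, ⟨m', M.large, wk, sp⟩) c := by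
      cases b₁ with
      | zero => exact .inl (hl' m' (h₁ _))
      | succ b₁ => exact (hl' m' (h₁ _)).imp id fun h => (h wk sp hsp).1
    have progR : (∃ t₂, right = .done t₂ ∧ Q₂ t₂ m') ∨
        ∃ c, Step M.ω M.prog (right, ⟨m', M.large, wk, sp⟩) c := by
      cases b₂ with
      | zero => exact .inl (hr' m' (h₁ _))
      | succ b₂ => exact (hr' m' (h₁ _)).imp id fun h => (h wk sp hsp).1
    constructor
    · rcases progL with ⟨t₁, rfl, -⟩ | ⟨⟨_, _⟩, h⟩
      · rcases progR with ⟨t₂, rfl, -⟩ | ⟨⟨_, _⟩, h⟩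
        · exact ⟨_, .join⟩
        · exact ⟨_, .right h⟩
      · exact ⟨_, .left h⟩
    · intro th' σ' hst
      cases hst with
      | left h =>
        obtain ⟨g1, g2, g3, g4, g5⟩ := stepL _ _ h
        exact ⟨g1, g2, g3, g4, g5⟩
      | right h =>
        obtain ⟨g1, g2, g3, g4, g5⟩ := stepR _ _ h
        exact ⟨g1, g2, g3, g4, g5⟩
      | join =>
        rcases progL with ⟨t₁, e₁, q₁⟩ | ⟨_, h⟩
        · rcases progR with ⟨t₂, e₂, q₂⟩ | ⟨_, h⟩
          · cases e₁
            cases e₂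
            exact ⟨rfl, by simp, hsp, p.guar_refl _, (hj _ _ _ hm' q₁ q₂).mono (by omega)⟩
          · cases h
        · cases h

theorem Safe.fork (hrely : ∀ a c, p.rely a c → r a c) (hguar : ∀ a c, r a c → p.guar a c) {d : ℕ}
    (h : M.prog[pc]? = some (.fork d))
    (hl : Safe M (.uniform r h₁ h₂) Q₁ b₁ (.run (pc + 1) (Function.update R d 1) (t + 1)) m)
    (hr : Safe M (.uniform r h₁ h₂) Q₂ b₂ (.run (pc + 1) (Function.update R d 2) (t + 1)) m)
    (hj : ∀ t₁ t₂ m', r m m' → Q₁ t₁ m' → Q₂ t₂ m' →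
      Safe M p Q b (.run (pc + 1) (Function.update R d 0) (max t₁ t₂)) m') :
    Safe M p Q (b₁ + b₂ + b + 2) (.run pc R t) m :=
  .exec h fun m' hm _ _ hsp => ⟨rfl, le_rfl, hsp, p.guar_refl m',
    .wait hrely hguar (hl.of_rely (p := .uniform r h₁ h₂) (hrely _ _ hm))
      (hr.of_rely (p := .uniform r h₁ h₂) (hrely _ _ hm))
      fun t₁ t₂ m'' hm'' => hj t₁ t₂ m'' (h₂ (hrely _ _ hm) hm'')⟩

end Instructions

end Safe

/-! ### Heap-ordered binary trees, sums and prefix sums -/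

section Heap

/-- A value computed bottom-up in the complete binary tree with nodes `1, …, 2 * N - 1`, where the
children of `k < N` are `2 * k` and `2 * k + 1` and the nodes `k ≥ N` are leaves: the sum of `g`
over the leaves below `k`, plus `c` for each inner node. -/
def treeSum (N c : ℕ) (g : ℕ → ℕ) (k : ℕ) : ℕ :=
  if k = 0 ∨ N ≤ k then g k else c + treeSum N c g (2 * k) + treeSum N c g (2 * k + 1)
termination_by N - k
decreasing_by all_goals omega

variable {N c : ℕ} {g : ℕ → ℕ}

theorem treeSum_leaf {k : ℕ} (h : N ≤ k) : treeSum N c g k = g k := by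
  rw [treeSum, if_pos (.inr h)]

theorem treeSum_node {k : ℕ} (h₀ : 0 < k) (h : k < N) :
    treeSum N c g k = c + treeSum N c g (2 * k) + treeSum N c g (2 * k + 1) := by
  rw [treeSum, if_neg (by omega)]

/-- The nodes `j, …, 2 * j - 1` form a cut of the tree. Passing to `j + 1` replaces node `j` by its
two children. At `j = N` the cut consists of the leaves, for every `N` and not only for powers of
two. -/
theorem treeSum_one_eq_sum_level {j : ℕ} (h₀ : 0 < j) (h : j ≤ N) :
    treeSum N c g 1 = c * (j - 1) + ∑ k ∈ Finset.Ico j (2 * j), treeSum N c g k := by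
  induction j, h₀ using Nat.le_induction with
  | base => simp
  | succ j hj ih =>
    rw [ih (by omega), Finset.sum_eq_sum_Ico_succ_bot (by omega),
      treeSum_node (by omega) (by omega), show 2 * (j + 1) = 2 * j + 1 + 1 by ring,
      Finset.sum_Ico_succ_top (by omega), Finset.sum_Ico_succ_top (by omega)]
    obtain ⟨i, rfl⟩ : ∃ i, j = i + 1 := ⟨j - 1, by omega⟩
    simp only [Nat.add_sub_cancel]
    ring

theorem treeSum_one (h : 0 < N) :
    treeSum N c g 1 = c * (N - 1) + ∑ i ∈ Finset.range N, g (N + i) := by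
  rw [treeSum_one_eq_sum_level h le_rfl, Finset.sum_Ico_eq_sum_range,
    show 2 * N - N = N by omega]
  congr 1
  exact Finset.sum_congr rfl fun i _ => treeSum_leaf (by omega)

/-- `j` is a descendant of `k` (or `k` itself). -/
def IsBelow (k j : ℕ) : Prop := ∃ i, j / 2 ^ i = k

theorem isBelow_one {j : ℕ} (h : 0 < j) : IsBelow 1 j :=
  ⟨Nat.log 2 j, by
    have h1 := Nat.pow_log_le_self 2 h.ne'
    have h2 := Nat.lt_pow_succ_log_self (b := 2) (by norm_num) j
    rw [pow_succ] at h2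
    exact Nat.div_eq_of_lt_le (by omega) (by omega)⟩

theorem IsBelow.cases {k j : ℕ} (h : IsBelow k j) :
    j = k ∨ IsBelow (2 * k) j ∨ IsBelow (2 * k + 1) j := by
  obtain ⟨i, hi⟩ := h
  cases i with
  | zero => left; simpa using hi
  | succ i =>
    rw [pow_succ, ← Nat.div_div_eq_div_mul] at hi
    rcases Nat.mod_two_eq_zero_or_one (j / 2 ^ i) with h | h
    · exact .inr (.inl ⟨i, by omega⟩)
    · exact .inr (.inr ⟨i, by omega⟩)

/-- A proper ancestor of a node below `2 * N` is at most half of it, hence an inner node. -/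
theorem IsBelow.eq_of_leaf {k j : ℕ} (h : IsBelow k j) (hk : N ≤ k) (hj : j < 2 * N) : j = k := by
  obtain ⟨i, hi⟩ := h
  cases i with
  | zero => simpa using hi
  | succ i =>
    rw [pow_succ, ← Nat.div_div_eq_div_mul] at hi
    have := Nat.div_le_self j (2 ^ i)
    omega

/-- The sum of `g` over the leaves that a left-to-right traversal meets before node `k`. -/
def treeOffset (N : ℕ) (g : ℕ → ℕ) (k : ℕ) : ℕ :=
  if k ≤ 1 then 0 else
    treeOffset N g (k / 2) + if k % 2 = 1 then treeSum N 0 g (k - 1) else 0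
termination_by k
decreasing_by omega

theorem treeOffset_one : treeOffset N g 1 = 0 := by rw [treeOffset, if_pos le_rfl]

theorem treeOffset_left {k : ℕ} (h : 0 < k) : treeOffset N g (2 * k) = treeOffset N g k := by
  rw [treeOffset, if_neg (by omega), if_neg (by omega), show 2 * k / 2 = k by omega, add_zero]

theorem treeOffset_right {k : ℕ} (h : 0 < k) :
    treeOffset N g (2 * k + 1) = treeOffset N g k + treeSum N 0 g (2 * k) := by
  rw [treeOffset, if_neg (by omega), if_pos (by omega), show (2 * k + 1) / 2 = k by omega,
    Nat.add_sub_cancel]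

/-- Give node `k` the interval that starts at its offset and has its sum as length. Along a cut
these intervals are disjoint and lie inside that of the root, because replacing a node by its
children splits its interval in two. At `j = N` this makes the slots of the leaves disjoint. -/
theorem treeOffset_level {j : ℕ} (h₀ : 0 < j) (h : j ≤ N) {k : ℕ} (hk : j ≤ k) (hk' : k < 2 * j) :
    treeOffset N g k + treeSum N 0 g k ≤ treeSum N 0 g 1 ∧
      ∀ l, j ≤ l → l < 2 * j → k ≠ l → treeOffset N g k + treeSum N 0 g k ≤ treeOffset N g l ∨
        treeOffset N g l + treeSum N 0 g l ≤ treeOffset N g k := by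
  induction j, h₀ using Nat.le_induction generalizing k with
  | base =>
    obtain rfl : k = 1 := by omega
    refine ⟨by rw [treeOffset_one, zero_add], fun l h1 h2 h3 => by omega⟩
  | succ j hj ih =>
    have hs := treeSum_node (c := 0) (g := g) (N := N) (k := j) hj (by omega)
    have hl := treeOffset_left (N := N) (g := g) hj
    have hr := treeOffset_right (N := N) (g := g) hj
    have key := fun {k} => @ih (by omega) k
    have hself := key (k := j) le_rfl (by omega)
    by_cases h1 : k = 2 * j
    · subst h1
      refine ⟨by omega, fun l h2 h3 h4 => ?_⟩
      by_cases h5 : l = 2 * j + 1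
      · subst h5; omega
      · have := hself.2 l (by omega) (by omega) (by omega)
        omega
    · by_cases h1' : k = 2 * j + 1
      · subst h1'
        refine ⟨by omega, fun l h2 h3 h4 => ?_⟩
        by_cases h5 : l = 2 * j
        · subst h5; omega
        · have := hself.2 l (by omega) (by omega) (by omega)
          omega
      · have hk := key (k := k) (by omega) (by omega)
        refine ⟨hk.1, fun l h2 h3 h4 => ?_⟩
        by_cases h5 : l = 2 * j
        · subst h5
          have := hk.2 j le_rfl (by omega) (by omega)
          omega
        · by_cases h6 : l = 2 * j + 1
          · subst h6
            have := hk.2 j le_rfl (by omega) (by omega)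
            omega
          · exact hk.2 l (by omega) (by omega) h4

theorem treeOffset_add_lt {k e : ℕ} (hk : N ≤ k) (hk' : k < 2 * N) (he : e < g k) :
    treeOffset N g k + e < treeSum N 0 g 1 := by
  have := (treeOffset_level (g := g) (N := N) (by omega) le_rfl hk hk').1
  rw [treeSum_leaf hk] at this
  omega

theorem treeOffset_add_injective {k l e f : ℕ} (hk : N ≤ k) (hk' : k < 2 * N) (he : e < g k)
    (hl : N ≤ l) (hl' : l < 2 * N) (hf : f < g l)
    (h : treeOffset N g k + e = treeOffset N g l + f) : k = l ∧ e = f := by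
  by_cases hkl : k = l
  · subst hkl
    exact ⟨rfl, by omega⟩
  · have := (treeOffset_level (g := g) (N := N) (by omega) le_rfl hk hk').2 l hl hl' hkl
    rw [treeSum_leaf hk, treeSum_leaf hl] at this
    omega

end Heap

/-! ### The program -/

/-- Breadth-first search.  Registers: `0` source, `1` number of vertices `n`, `2` the largest word,
`3` the constant `1`, `4` and `5` addresses of the current and the next frontier, `6` address of the
tree of degree sums, `7` length of the current frontier, `8` node of a loop tree, `9` fork result,
`12` offset of a node, `13` vertex, `14` its degree, `15` address of its adjacency list, `16` address
of its slots in the next frontier, `17` sum of the degrees of the frontier, `18` length of the next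
frontier, `19` and `20` address and length of the array to fill, `21` whether the round is dense,
`22` the constant `0`. -/
def bfs : Program :=
  -- Register `9` is still `0`: it yields the largest word as `0 - 1`, and it addresses the word
  -- that holds `n`. Small-memory layout: parents from `0`, frontiers from `n` and `2 * n`, degree
  -- sums from `3 * n`. Adding register `22` copies a register.
  [ .const 3 1, .op .sub 2 9 3, .load .large 1 9, .op .add 4 1 22, .op .add 5 4 1, .op .add 6 5 1,
    .op .add 20 1 22, .const 8 1,
    -- 8: fill the parent array
    .fork 9, .jumpZero 9 13, .op .sub 10 3 9, .jumpZero 10 47, .halt,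
    -- 13: the first frontier
    .store .small 0 0, .store .small 4 0, .const 7 1,
    -- 16: a round; degree sums
    .fork 9, .jumpZero 9 21, .op .sub 10 3 9, .jumpZero 10 59, .halt,
    -- The root of the tree holds the total degree. It decides whether to stop and, compared with
    -- `n`, whether edges or vertices own the slots.
    .op .add 10 6 3, .load .small 17 10, .jumpZero 17 46, .op .lt 21 1 17, .jumpZero 21 28,
    .op .add 18 1 22, .jump 29, .op .add 18 17 22,
    -- 29: clear the next frontier
    .op .add 19 5 22, .op .add 20 18 22,
    .fork 9, .jumpZero 9 36, .op .sub 10 3 9, .jumpZero 10 47, .halt,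
    -- 36: explore the edges
    .fork 9, .jumpZero 9 41, .op .sub 10 3 9, .jumpZero 10 88, .halt,
    .op .add 10 4 22, .op .add 4 5 22, .op .add 5 10 22, .op .add 7 18 22, .jump 16,
    .halt,
    -- 47: loop that fills an array with the largest word
    .op .lt 10 8 20, .jumpZero 10 55, .op .add 11 8 8, .fork 9, .jumpZero 9 46, .op .add 8 11 9,
    .op .sub 8 8 3, .jump 47,
    .op .sub 10 8 20, .op .add 10 10 19, .store .small 10 2, .halt,
    -- 59: loop that computes degree sums
    .op .lt 10 8 7, .jumpZero 10 73, .op .add 11 8 8, .fork 9, .jumpZero 9 67, .op .add 8 11 9,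
    .op .sub 8 8 3, .jump 59,
    .op .add 10 6 11, .load .small 13 10, .op .add 10 10 3, .load .small 14 10, .op .add 14 13 14,
    .jump 85,
    .op .sub 10 8 7, .op .add 10 10 4, .load .small 13 10, .op .eq 11 13 2, .jumpZero 11 80,
    .const 14 0, .jump 85,
    .op .add 10 13 3, .load .large 11 10, .op .add 10 10 3, .load .large 14 10, .op .sub 14 14 11,
    .op .add 10 6 8, .store .small 10 14, .halt,
    -- 88: loop over the frontier
    .op .lt 10 8 7, .jumpZero 10 101, .op .add 11 8 8, .fork 9, .jumpZero 9 46, .op .add 8 11 9,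
    -- A left child inherits the offset; a right child adds the degree sum of its left sibling.
    .op .sub 8 8 3, .op .sub 9 9 3, .jumpZero 9 88, .op .add 10 6 11, .load .small 11 10,
    .op .add 12 12 11, .jump 88,
    .op .sub 10 8 7, .op .add 10 10 4, .load .small 13 10, .op .eq 11 13 2, .jumpZero 11 107, .halt,
    .op .add 10 13 3, .load .large 11 10, .op .add 10 10 3, .load .large 14 10, .op .sub 14 14 11,
    .jumpZero 14 46, .op .add 15 11 1, .op .add 15 15 3, .op .add 15 15 3, .op .add 16 5 12,
    .const 8 1,
    -- 118: loop over the edges of a vertex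
    .op .lt 10 8 14, .jumpZero 10 126, .op .add 11 8 8, .fork 9, .jumpZero 9 46, .op .add 8 11 9,
    .op .sub 8 8 3, .jump 118,
    -- The result of the compare-and-swap is discarded and the parent is read back, so that whether
    -- a claim has been processed depends on the memory alone.
    .op .sub 8 8 14, .op .add 10 15 8, .load .large 11 10, .cas .small 10 11 2 13,
    .load .small 10 11, .op .eq 10 10 13, .jumpZero 10 46, .jumpZero 21 137, .op .add 10 5 11,
    .store .small 10 11, .halt,
    .op .add 10 16 8, .store .small 10 11, .halt ]

/-! ### Machine arithmetic without overflow -/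

section Words

variable {w : ℕ}

theorem eval_add (a b : ℕ) :
    BinOp.add.eval (BitVec.ofNat w a) (BitVec.ofNat w b) = BitVec.ofNat w (a + b) :=
  (BitVec.ofNat_add a b).symm

theorem eval_sub {a b : ℕ} (h : b ≤ a) :
    BinOp.sub.eval (BitVec.ofNat w a) (BitVec.ofNat w b) = BitVec.ofNat w (a - b) := by
  obtain ⟨c, rfl⟩ := Nat.exists_eq_add_of_le h
  simp only [BinOp.eval, BitVec.ofNat_add, Nat.add_sub_cancel_left]
  exact add_sub_cancel_left _ _

theorem toNat_ofNat_of_lt {a : ℕ} (ha : a < 2 ^ w) : (BitVec.ofNat w a).toNat = a := by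
  rw [BitVec.toNat_ofNat, Nat.mod_eq_of_lt ha]

theorem eval_lt_of_lt {a b : ℕ} (h : a < b) (hb : b < 2 ^ w) :
    BinOp.lt.eval (BitVec.ofNat w a) (BitVec.ofNat w b) = BitVec.ofNat w 1 := by
  rw [BinOp.eval, toNat_ofNat_of_lt hb, toNat_ofNat_of_lt (h.trans hb), if_pos h]
  rfl

theorem eval_lt_of_le {a b : ℕ} (h : b ≤ a) (ha : a < 2 ^ w) :
    BinOp.lt.eval (BitVec.ofNat w a) (BitVec.ofNat w b) = BitVec.ofNat w 0 := by
  rw [BinOp.eval, toNat_ofNat_of_lt ha, toNat_ofNat_of_lt (h.trans_lt ha), if_neg (by omega)]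
  rfl

theorem eval_eq_of_eq {a b : BitVec w} (h : a = b) : BinOp.eq.eval a b = BitVec.ofNat w 1 :=
  if_pos h

theorem eval_eq_of_ne {a b : BitVec w} (h : a ≠ b) : BinOp.eq.eval a b = BitVec.ofNat w 0 :=
  if_neg h

theorem ofNat_inj {a b : ℕ} (ha : a < 2 ^ w) (hb : b < 2 ^ w) :
    BitVec.ofNat w a = BitVec.ofNat w b ↔ a = b :=
  ⟨fun h => by rw [← toNat_ofNat_of_lt ha, h, toNat_ofNat_of_lt hb], fun h => by rw [h]⟩

theorem ofNat_ne_allOnes {a : ℕ} (ha : a + 1 < 2 ^ w) : BitVec.ofNat w a ≠ BitVec.allOnes w := by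
  intro h
  have := congrArg BitVec.toNat h
  rw [toNat_ofNat_of_lt (by omega), BitVec.toNat_allOnes] at this
  omega

theorem ofNat_ne_zero {a : ℕ} (h : 0 < a) (ha : a < 2 ^ w) : BitVec.ofNat w a ≠ 0 :=
  fun e => h.ne' ((ofNat_inj ha (Nat.two_pow_pos w)).1 e)

end Words

/-! ### Parallel loops as fork trees -/

section Tree

variable {w : ℕ} {M : Machine w} {r : Mem w → Mem w → Prop} {h₁ : ∀ m, r m m}
  {h₂ : ∀ {a b c}, r a b → r b c → r a c}

/-- A parallel loop over the leaves of the complete binary tree with `N` leaves. -/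
theorem Safe.tree {L leaf after bound N : ℕ}
    (i₀ : M.prog[L]? = some (.op .lt 10 8 bound))
    (i₁ : M.prog[L + 1]? = some (.jumpZero 10 leaf))
    (i₂ : M.prog[L + 2]? = some (.op .add 11 8 8))
    (i₃ : M.prog[L + 3]? = some (.fork 9))
    (i₄ : M.prog[L + 4]? = some (.jumpZero 9 after))
    (i₅ : M.prog[L + 5]? = some (.op .add 8 11 9))
    (i₆ : M.prog[L + 6]? = some (.op .sub 8 8 3))
    (hN : 2 * N < 2 ^ w)
    {A : ℕ → Regs w → Prop}
    (hA : ∀ k R, A k R → R 8 = .ofNat w k ∧ R bound = .ofNat w N ∧ R 3 = .ofNat w 1)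
    {I : Mem w → Prop} (hI : ∀ m m', I m → r m m' → I m') {post : ℕ → Mem w → Prop}
    {cl ca ct : ℕ} {g : ℕ → ℕ}
    (hleaf : ∀ k R t m, N ≤ k → k < 2 * N → A k R → I m →
      Safe M (.uniform r h₁ h₂) (fun t' m' => t' ≤ t + cl ∧ post k m') (g k)
        (.run leaf (Function.update R 10 (.ofNat w 0)) t) m)
    (hafter : ∀ k R t m, 0 < k → k < N → A k R → I m → post (2 * k) m → post (2 * k + 1) m →
      Safe M (.uniform r h₁ h₂) (fun t' m' => t' ≤ t + ca ∧ post k m') ca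
        (.run after (Function.update (Function.update (Function.update R 10 (.ofNat w 1)) 11
          (.ofNat w (2 * k))) 9 0) t) m)
    (htail : ∀ k d R (t : ℝ) m Q b, 0 < k → k < N → d < 2 → A k R → I m →
      (∀ R' (t' : ℝ) m', r m m' → A (2 * k + d) R' → t' ≤ t + ct →
        Safe M (.uniform r h₁ h₂) Q b (.run L R' t') m') →
      Safe M (.uniform r h₁ h₂) Q (b + ct)
        (.run (L + 7) (Function.update (Function.update (Function.update (Function.update R 10
          (.ofNat w 1)) 11 (.ofNat w (2 * k))) 9 (.ofNat w (d + 1))) 8 (.ofNat w (2 * k + d))) t) m)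
    (h : ℕ) {k : ℕ} {R : Regs w} {t : ℝ} {m : Mem w} (hk : 0 < k) (hk' : k < 2 * N)
    (hh : N ≤ k * 2 ^ h) (hR : A k R) (hm : I m) :
    Safe M (.uniform r h₁ h₂)
      (fun t' m' => t' ≤ t + ((h * (8 + ct + ca) + cl + 2 : ℕ) : ℝ) ∧ post k m')
      (treeSum N (2 * ct + ca + 12) (fun k => g k + 2) k) (.run L R t) m := by
  induction h generalizing k R t m with
  | zero =>
    have hkN : N ≤ k := by simpa using hh
    obtain ⟨h8, hB, -⟩ := hA k R hR
    rw [treeSum_leaf hkN]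
    refine .op i₀ (.jumpZero_taken i₁ ?_ ?_)
    · rw [Function.update_self, h8, hB, eval_lt_of_le hkN (by omega)]; rfl
    · rw [h8, hB, eval_lt_of_le hkN (by omega)]
      refine (hleaf k R _ m hkN hk' hR hm).weaken fun t' m' ⟨ht, hp⟩ => ⟨?_, hp⟩
      push_cast
      linarith
  | succ h ih =>
    obtain ⟨h8, hB, h3⟩ := hA k R hR
    by_cases hkN : N ≤ k
    · rw [treeSum_leaf hkN]
      refine .op i₀ (.jumpZero_taken i₁ ?_ ?_)
      · rw [Function.update_self, h8, hB, eval_lt_of_le hkN (by omega)]; rfl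
      · rw [h8, hB, eval_lt_of_le hkN (by omega)]
        refine (hleaf k R _ m hkN hk' hR hm).weaken fun t' m' ⟨ht, hp⟩ => ⟨?_, hp⟩
        have : (0 : ℝ) ≤ ((h + 1 : ℕ) : ℝ) * (8 + ct + ca) := by positivity
        push_cast at this ⊢
        linarith
    · rw [not_le] at hkN
      rw [treeSum_node hk hkN]
      have hlt : BinOp.lt.eval (R 8) (R bound) = .ofNat w 1 := by
        rw [h8, hB, eval_lt_of_lt hkN (by omega)]
      -- Up to and including the fork 4 instructions run, then 3 in each child before its tail;
      -- after the join there is one jump before the code at `after`. This gives depth `8 + ct + ca`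
      -- per level and, with both children and the join counted, `2 * ct + ca + 12` steps per inner
      -- node.
      have child : ∀ d, d < 2 →
          Safe M (.uniform r h₁ h₂) (fun t' m' => t' ≤ t + 4 + 3 + ct +
            ((h * (8 + ct + ca) + cl + 2 : ℕ) : ℝ) ∧ post (2 * k + d) m')
            (treeSum N (2 * ct + ca + 12) (fun k => g k + 2) (2 * k + d) + ct + 3)
            (.run (L + 4) (Function.update (Function.update (Function.update R 10 (.ofNat w 1)) 11
              (.ofNat w (2 * k))) 9 (.ofNat w (d + 1))) (t + 3 + 1)) m := by
        intro d hd
        refine .jumpZero_not_taken i₄ ?_ (.op i₅ (.op i₆ ?_))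
        · rw [Function.update_self]
          exact ofNat_ne_zero (by omega) (by omega)
        · have := htail k d R (t + 3 + 1 + 3) m (fun t' m' => t' ≤ t + 4 + 3 + ct +
            ((h * (8 + ct + ca) + cl + 2 : ℕ) : ℝ) ∧ post (2 * k + d) m') _ hk hkN hd hR hm
            fun R' t' m' hr' hR' ht' => (ih (by omega) (by omega) (hh.trans (by
              rw [pow_succ]; nlinarith [Nat.zero_le (d * 2 ^ h)])) hR' (hI _ _ hm hr')).weaken
              fun t'' m'' ⟨ht'', hp⟩ => ⟨by linarith, hp⟩
          have e : (t + 3 + 1 + 3 : ℝ) = t + 3 + 1 + 1 + 1 + 1 := by ring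
          rw [e] at this
          simp only [Function.update_self, Function.update_of_ne (show (11 : ℕ) ≠ 9 by decide),
            Function.update_of_ne (show (3 : ℕ) ≠ 8 by decide),
            Function.update_of_ne (show (3 : ℕ) ≠ 9 by decide),
            Function.update_of_ne (show (3 : ℕ) ≠ 10 by decide),
            Function.update_of_ne (show (3 : ℕ) ≠ 11 by decide), h3, eval_add,
            Function.update_idem]
          rw [eval_sub (by omega), show 2 * k + (d + 1) - 1 = 2 * k + d by omega]
          exact this
      have c₁ := child 0 (by omega)
      have c₂ := child 1 (by omega)
      have hfork := Safe.fork (p := .uniform r h₁ h₂) (b := ca + 1)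
        (Q := fun t' m' => t' ≤ t + (((h + 1) * (8 + ct + ca) + cl + 2 : ℕ) : ℝ) ∧ post k m')
        (R := Function.update (Function.update R 10 (.ofNat w 1)) 11 (.ofNat w (2 * k)))
        (t := t + 3) (fun _ _ h => h) (fun _ _ h => h) i₃
        c₁ c₂
        fun t₁ t₂ m' hr' q₁ q₂ => .jumpZero_taken i₄ (Function.update_self ..)
          ((hafter k R _ m' hk hkN hR (hI _ _ hm hr') q₁.2 q₂.2).weaken fun t' m'' ht' => ⟨?_, ht'.2⟩)
      · refine Safe.mono (b := treeSum N (2 * ct + ca + 12) (fun k => g k + 2) (2 * k + 0) + ct + 3 +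
          (treeSum N (2 * ct + ca + 12) (fun k => g k + 2) (2 * k + 1) + ct + 3) + (ca + 1) + 2 +
          1 + 1 + 1) (.op i₀ (.jumpZero_not_taken i₁ ?_ (.op i₂ ?_))) ?_
        rotate_left
        · rw [hlt, Function.update_of_ne (by decide), h8, eval_add, ← two_mul,
            show t + 1 + 1 + 1 = t + 3 by ring]
          exact hfork
        · simp only [add_zero]
          omega
        · rw [Function.update_self, hlt]
          exact ofNat_ne_zero one_pos (by omega)
      · have := max_le q₁.1 q₂.1
        have := ht'.1
        push_cast at *
        linarith

end Tree

/-! ### Loops that write prescribed values -/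

section Writing

variable {w : ℕ}

/-- Only the writes in `W` (pairs of an address and a value) have happened. -/
def WriteRel (W : Set (BitVec w × BitVec w)) (m m' : Mem w) : Prop :=
  ∀ a, m' a = m a ∨ (a, m' a) ∈ W

theorem WriteRel.refl {W : Set (BitVec w × BitVec w)} (m : Mem w) : WriteRel W m m :=
  fun _ => .inl rfl

theorem WriteRel.trans {W : Set (BitVec w × BitVec w)} {a b c : Mem w} (hab : WriteRel W a b)
    (hbc : WriteRel W b c) : WriteRel W a c := fun x => by
  rcases hbc x with h | h
  · rw [h]
    exact hab x
  · exact .inr h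

/-- The protocol of threads that perform only writes in `W`. -/
def Protocol.writing (W : Set (BitVec w × BitVec w)) : Protocol w :=
  .uniform (WriteRel W) WriteRel.refl WriteRel.trans

variable {W : Set (BitVec w × BitVec w)} {m m' : Mem w} {a x : BitVec w}

/-- If only one value may ever be written to an address, then rewriting it is harmless: a cell that
holds its final value keeps it under any interference. -/
theorem WriteRel.stable (h : WriteRel W m m') (hW : ∀ y, (a, y) ∈ W → y = x) (ha : m a = x) :
    m' a = x := by
  rcases h a with h | h
  · rw [h, ha]
  · exact hW _ h

theorem WriteRel.update (h : (a, x) ∈ W) : WriteRel W m (Function.update m a x) := fun b => by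
  by_cases hb : b = a
  · subst hb
    rw [Function.update_self]
    exact .inr h
  · rw [Function.update_of_ne hb]
    exact .inl rfl

end Writing

/-- The machine that runs `bfs` on the input `large` with `sp` words of small-memory. -/
def bfsMachine {w : ℕ} (ω : ℝ) (large : Mem w) (sp : ℕ) : Machine w := ⟨ω, bfs, large, sp⟩

section Loops

variable {w : ℕ} {ω : ℝ} {large : Mem w} {sp : ℕ}

/-- The root thread runs a loop to its end: it forks a child that executes the loop, and a child
that terminates at once. -/
theorem safe_call {r : Mem w → Mem w → Prop} {h₁ : ∀ m, r m m}
    {h₂ : ∀ {a b c}, r a b → r b c → r a c} {pc loop : ℕ}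
    (i₀ : bfs[pc]? = some (.fork 9)) (i₁ : bfs[pc + 1]? = some (.jumpZero 9 (pc + 5)))
    (i₂ : bfs[pc + 2]? = some (.op .sub 10 3 9)) (i₃ : bfs[pc + 3]? = some (.jumpZero 10 loop))
    (i₄ : bfs[pc + 4]? = some .halt) (hw : 2 < 2 ^ w)
    {R : Regs w} (h3 : R 3 = .ofNat w 1) {P : Mem w → Prop} {Q : ℝ → Mem w → Prop}
    {b₁ b c : ℕ} {t : ℝ} {m : Mem w}
    (hl : Safe (bfsMachine ω large sp) (.uniform r h₁ h₂) (fun t' m' => t' ≤ t + 4 + c ∧ P m') b₁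
      (.run loop (Function.update (Function.update R 9 1) 10 0) (t + 4)) m)
    (hj : ∀ t' m', t' ≤ t + 6 + c → r m m' → P m' →
      Safe (bfsMachine ω large sp) (.alone w) Q b (.run (pc + 5) (Function.update R 9 0) t') m') :
    Safe (bfsMachine ω large sp) (.alone w) Q (b₁ + b + 10) (.run pc R t) m := by
  have hf := Safe.fork (M := bfsMachine ω large sp) (p := .alone w) (r := r) (h₁ := h₁) (h₂ := h₂)
    (Q := Q) (b₁ := b₁ + 3) (b₂ := 4) (b := b + 1) (Q₁ := fun t' m' => t' ≤ t + 4 + c ∧ P m')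
    (Q₂ := fun t' _ => t' ≤ t + 5) (R := R) (t := t) (m := m) (d := 9)
    (by rintro _ _ rfl; exact h₁ _) (fun _ _ _ => trivial) i₀ ?_ ?_ ?_
  · exact hf.mono (by omega)
  · refine .jumpZero_not_taken i₁ ?_ (.op i₂ (.jumpZero_taken i₃ ?_ ?_))
    · rw [Function.update_self]
      exact ofNat_ne_zero one_pos (show 1 < 2 ^ w by omega)
    · simp [h3, BinOp.eval]
    · have e : BinOp.sub.eval (Function.update R 9 1 3) (Function.update R 9 1 9) = 0 := by
        simp [h3, BinOp.eval]
      rw [e, show t + 1 + 1 + 1 + 1 = t + 4 by ring]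
      exact hl
  -- The second child holds `2` in register `9`, so `1 - 2` is nonzero and it falls through to
  -- `halt`.
  · refine .jumpZero_not_taken i₁ ?_ (.op i₂ (.jumpZero_not_taken i₃ ?_ (.halt i₄ ?_)))
    · rw [Function.update_self]
      exact ofNat_ne_zero two_pos (by omega)
    · rw [Function.update_self, Function.update_self, Function.update_of_ne (by decide), h3]
      intro h
      have h' := sub_eq_zero.1 h
      have := (ofNat_inj (show 1 < 2 ^ w by omega) (show 2 < 2 ^ w by omega)).1 h'
      omega
    · intro m' _
      linarith
  · intro t₁ t₂ m' hr q₁ q₂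
    refine .jumpZero_taken i₁ (Function.update_self ..) (hj _ _ ?_ hr q₁.2)
    have := max_le (q₁.1.trans (show _ ≤ t + 5 + c by linarith))
      (q₂.trans (show _ ≤ t + 5 + c by linarith [c.cast_nonneg (α := ℝ)]))
    linarith

/-- The writes that fill `N` words from address `base` on with the largest word. -/
def fillWrites (w base N : ℕ) : Set (BitVec w × BitVec w) :=
  {x | ∃ i < N, x = (.ofNat w (base + i), .allOnes w)}

theorem safe_fill {base N : ℕ} (hN : 0 < N) (hN' : 2 * N < 2 ^ w) (hsp : base + N ≤ sp)
    (hw : sp < 2 ^ w) {h : ℕ} (hh : N ≤ 2 ^ h) {R : Regs w} {t : ℝ} {m : Mem w}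
    (h2 : R 2 = .allOnes w) (h3 : R 3 = .ofNat w 1) (h8 : R 8 = .ofNat w 1)
    (h19 : R 19 = .ofNat w base) (h20 : R 20 = .ofNat w N) :
    Safe (bfsMachine ω large sp) (.writing (fillWrites w base N))
      (fun t' m' => t' ≤ t + ((10 * h + 6 : ℕ) : ℝ) ∧
        ∀ i < N, m' (.ofNat w (base + i)) = .allOnes w) (21 * N) (.run 47 R t) m := by
  have key := Safe.tree (M := bfsMachine ω large sp) (r := WriteRel (fillWrites w base N))
    (h₁ := WriteRel.refl) (h₂ := WriteRel.trans) (L := 47) (leaf := 55) (after := 46) (bound := 20)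
    rfl rfl rfl rfl rfl rfl rfl hN'
    (A := fun k R => R 8 = .ofNat w k ∧ R 20 = .ofNat w N ∧ R 3 = .ofNat w 1 ∧ R 2 = .allOnes w ∧
      R 19 = .ofNat w base)
    (fun k R hR => ⟨hR.1, hR.2.1, hR.2.2.1⟩) (I := fun _ => True) (fun _ _ _ _ => trivial)
    (post := fun k m => ∀ i < N, IsBelow k (N + i) → m (.ofNat w (base + i)) = .allOnes w)
    -- Four instructions at a leaf, one `halt` after a join, one `jump` before recursing: 15 steps
    -- per inner node and 6 per leaf, hence at most `21 * N`.
    (cl := 4) (ca := 1) (ct := 1) (g := fun _ => 4) ?_ ?_ ?_ h (k := 1) one_pos (by omega)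
    (by omega) ⟨h8, h20, h3, h2, h19⟩ trivial (t := t) (m := m)
  · refine (key.mono ?_).weaken fun t' m' ht' => ⟨?_, fun i hi => ht'.2 i hi (isBelow_one (by omega))⟩
    · rw [treeSum_one hN, Finset.sum_const, Finset.card_range, smul_eq_mul]
      omega
    · have := ht'.1
      push_cast at *
      linarith
  · rintro k R t m hk hk' ⟨h8, h20, h3, h2, h19⟩ -
    obtain ⟨i, rfl⟩ := Nat.exists_eq_add_of_le hk
    refine .op rfl (.op rfl ?_)
    simp only [Function.update_self, Function.update_idem, ne_eq, not_false_eq_true,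
      Function.update_of_ne, Nat.reduceEqDiff, h8, h20, h19, eval_sub (Nat.le_add_right N i),
      Nat.add_sub_cancel_left, eval_add]
    refine .storeSmall rfl ?_ fun m' _ => ?_
    · rw [Function.update_self, toNat_ofNat_of_lt (by omega)]
      change _ < sp
      omega
    · have hmem : (BitVec.ofNat w (i + base), BitVec.allOnes w) ∈ fillWrites w base N :=
        ⟨i, by omega, by rw [add_comm]⟩
      simp only [Function.update_self, Function.update_of_ne (show (2 : ℕ) ≠ 10 by decide), h2]
      refine ⟨WriteRel.update hmem, .halt rfl fun m'' hm'' => ⟨?_, fun j hj hb => ?_⟩⟩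
      · push_cast
        linarith
      · have := hb.eq_of_leaf hk (by omega)
        obtain rfl : j = i := by omega
        refine WriteRel.stable hm'' ?_ ?_
        · rintro y ⟨_, _, e⟩
          exact (Prod.ext_iff.1 e).2
        · rw [add_comm, Function.update_self]
  · rintro k R t m hk hk' ⟨h8, h20, h3, h2, h19⟩ - hl hr
    refine .halt rfl fun m' hm' => ⟨by push_cast; linarith, fun i hi hb => ?_⟩
    have hW : ∀ y, (BitVec.ofNat w (base + i), y) ∈ fillWrites w base N → y = .allOnes w := by
      rintro y ⟨_, _, e⟩
      exact (Prod.ext_iff.1 e).2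
    rcases hb.cases with rfl | hb | hb
    · omega
    · exact WriteRel.stable hm' hW (hl i hi hb)
    · exact WriteRel.stable hm' hW (hr i hi hb)
  · rintro k d R t m Q b hk hk' hd ⟨h8, h20, h3, h2, h19⟩ - hs
    refine .jump rfl (hs _ _ _ (WriteRel.refl m) ?_ (by push_cast; linarith))
    simp [h20, h3, h2, h19]

end Loops

/-! ### Adjacency lists, frontiers and degree sums -/

/-- Adjacency lists: for each vertex its offset, its degree, and the entries of its list. -/
structure Lists where
  n : ℕ
  off : ℕ → ℕ
  deg : ℕ → ℕ
  adj : ℕ → ℕ → ℕ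

/-- The memory `large` holds the adjacency lists `C`. -/
structure Lists.Stored {w : ℕ} (C : Lists) (large : Mem w) : Prop where
  size : large (.ofNat w 0) = .ofNat w C.n
  off : ∀ u < C.n, large (.ofNat w (u + 1)) = .ofNat w (C.off u)
  off_succ : ∀ u < C.n, large (.ofNat w (u + 1 + 1)) = .ofNat w (C.off u + C.deg u)
  adj : ∀ u < C.n, ∀ e < C.deg u, large (.ofNat w (C.off u + C.n + 1 + 1 + e)) = .ofNat w (C.adj u e)
  adj_lt : ∀ u < C.n, ∀ e < C.deg u, C.adj u e < C.n
  deg_le : ∀ u < C.n, C.deg u ≤ C.n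

/-- A frontier: an array of length `len` whose entries are vertices or holes. -/
structure Frontier where
  len : ℕ
  entry : ℕ → Option ℕ

namespace Frontier

/-- The word that stands for an entry of a frontier. -/
def encode (w : ℕ) : Option ℕ → BitVec w
  | none => .allOnes w
  | some u => .ofNat w u

/-- The frontier `F` is stored from address `base` on. -/
def Stored {w : ℕ} (F : Frontier) (base : ℕ) (m : Mem w) : Prop :=
  ∀ i < F.len, m (.ofNat w (base + i)) = encode w (F.entry i)

/-- The degree of the entry at a leaf of the loop tree. -/
def leafDeg (F : Frontier) (C : Lists) (k : ℕ) : ℕ := (F.entry (k - F.len)).elim 0 C.deg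

/-- The sum of the degrees below a node of the loop tree. -/
def degSum (F : Frontier) (C : Lists) (k : ℕ) : ℕ := treeSum F.len 0 (F.leafDeg C) k

/-- The tree of degree sums is stored from address `3 * n` on. -/
def SumsStored {w : ℕ} (F : Frontier) (C : Lists) (m : Mem w) : Prop :=
  ∀ k, 0 < k → k < 2 * F.len → m (.ofNat w (3 * C.n + k)) = .ofNat w (F.degSum C k)

/-- The writes that store the tree of degree sums. -/
def sumWrites (F : Frontier) (C : Lists) (w : ℕ) : Set (BitVec w × BitVec w) :=
  {x | ∃ k, 0 < k ∧ k < 2 * F.len ∧ x = (.ofNat w (3 * C.n + k), .ofNat w (F.degSum C k))}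

end Frontier

section Loops

variable {w : ℕ} {ω : ℝ} {large : Mem w} {C : Lists} {F : Frontier} {base : ℕ}

theorem Frontier.Stored.of_sumWrites {m m' : Mem w} (h : F.Stored base m)
    (hr : WriteRel (F.sumWrites C w) m m') (hb : base + F.len ≤ 3 * C.n) (hF : F.len ≤ C.n)
    (hw : 5 * C.n < 2 ^ w) : F.Stored base m' := fun i hi => by
  refine WriteRel.stable hr ?_ (h i hi)
  rintro y ⟨k, h1, h2, e⟩
  have := (ofNat_inj (by omega) (by omega)).1 (Prod.ext_iff.1 e).1
  omega

/-- The loop postcondition at a node says that all sums below it are stored. A leaf stores a degree,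
with `0` for a hole; an inner node adds its children's sums after the join. The frontier lies below
the tree in memory, so it can be read throughout. -/
theorem safe_sums (hC : C.Stored large) (hw : 5 * C.n < 2 ^ w) (hF : 0 < F.len) (hF' : F.len ≤ C.n)
    (hFC : ∀ i < F.len, ∀ u, F.entry i = some u → u < C.n) (hb : base + F.len ≤ 3 * C.n)
    {h : ℕ} (hh : F.len ≤ 2 ^ h) {R : Regs w} {t : ℝ} {m : Mem w} (hm : F.Stored base m)
    (h2 : R 2 = .allOnes w) (h3 : R 3 = .ofNat w 1) (h4 : R 4 = .ofNat w base)
    (h6 : R 6 = .ofNat w (3 * C.n)) (h7 : R 7 = .ofNat w F.len) (h8 : R 8 = .ofNat w 1) :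
    Safe (bfsMachine ω large (5 * C.n)) (.writing (F.sumWrites C w))
      (fun t' m' => t' ≤ t + ((18 * h + 15 : ℕ) : ℝ) ∧ F.SumsStored C m') (38 * F.len)
      (.run 59 R t) m := by
  have hW : ∀ j < 2 * F.len, ∀ y, (BitVec.ofNat w (3 * C.n + j), y) ∈ F.sumWrites C w →
      y = .ofNat w (F.degSum C j) := by
    rintro j hj y ⟨k, h1, h2, e⟩
    obtain ⟨e1, e2⟩ := Prod.ext_iff.1 e
    have := (ofNat_inj (by omega) (by omega)).1 e1
    obtain rfl : j = k := by omega
    exact e2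
  let post : ℕ → Mem w → Prop := fun k m => ∀ j, 0 < j → j < 2 * F.len → IsBelow k j →
    m (.ofNat w (3 * C.n + j)) = .ofNat w (F.degSum C j)
  let A : ℕ → Regs w → Prop := fun k R => R 8 = .ofNat w k ∧ R 7 = .ofNat w F.len ∧
    R 3 = .ofNat w 1 ∧ R 2 = .allOnes w ∧ R 4 = .ofNat w base ∧ R 6 = .ofNat w (3 * C.n)
  -- Leaves and inner nodes share the final three instructions.
  have hstore : ∀ k R (t : ℝ) m, 0 < k → k < 2 * F.len → R 6 = .ofNat w (3 * C.n) →
      R 8 = .ofNat w k → R 14 = .ofNat w (F.degSum C k) →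
      (∀ j, 0 < j → j < 2 * F.len → IsBelow k j → j = k ∨
        m (.ofNat w (3 * C.n + j)) = .ofNat w (F.degSum C j)) →
      Safe (bfsMachine ω large (5 * C.n)) (.writing (F.sumWrites C w))
        (fun t' m' => t' ≤ t + 3 ∧ post k m') 3 (.run 85 R t) m := by
    intro k R t m hk hk' h6 h8 h14 hj
    refine .op rfl ?_
    simp only [h6, h8, eval_add]
    refine .storeSmall rfl ?_ fun m' hm' => ?_
    · rw [Function.update_self, toNat_ofNat_of_lt (by omega)]
      change _ < 5 * C.n
      omega
    · simp only [Function.update_self, Function.update_of_ne (show (14 : ℕ) ≠ 10 by decide), h14]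
      have hmem : (BitVec.ofNat w (3 * C.n + k), BitVec.ofNat w (F.degSum C k)) ∈ F.sumWrites C w :=
        ⟨k, hk, hk', rfl⟩
      refine ⟨WriteRel.update hmem, .halt rfl fun m'' hm'' => ⟨by linarith, fun j h1 h2 hb => ?_⟩⟩
      refine WriteRel.stable hm'' (hW j h2) ?_
      rcases hj j h1 h2 hb with rfl | e
      · rw [Function.update_self]
      · exact WriteRel.stable (WriteRel.trans hm' (WriteRel.update hmem)) (hW j h2) e
  have key := Safe.tree (M := bfsMachine ω large (5 * C.n)) (r := WriteRel (F.sumWrites C w))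
    (h₁ := WriteRel.refl) (h₂ := WriteRel.trans) (L := 59) (leaf := 73) (after := 67) (bound := 7)
    rfl rfl rfl rfl rfl rfl rfl (N := F.len) (by omega) (A := A)
    (fun k R hR => ⟨hR.1, hR.2.1, hR.2.2.1⟩) (I := F.Stored base)
    (fun _ _ h hr => h.of_sumWrites hr hb hF' hw) (post := post) (cl := 13) (ca := 9) (ct := 1)
    (g := fun _ => 13) ?_ ?_ ?_ h (k := 1) one_pos (by omega) (by omega)
    ⟨h8, h7, h3, h2, h4, h6⟩ hm (t := t)
  · refine (key.mono ?_).weaken fun t' m' ht' => ⟨?_, fun k h1 h2 => ht'.2 k h1 h2 (isBelow_one h1)⟩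
    · rw [treeSum_one hF, Finset.sum_const, Finset.card_range, smul_eq_mul]
      omega
    · have := ht'.1
      push_cast at *
      linarith
  · rintro k R t m hk hk' ⟨h8, h7, h3, h2, h4, h6⟩ hm
    obtain ⟨i, rfl⟩ := Nat.exists_eq_add_of_le hk
    have hleaf : ∀ m : Mem w, ∀ j, 0 < j → j < 2 * F.len → IsBelow (F.len + i) j → j = F.len + i ∨
        m (.ofNat w (3 * C.n + j)) = .ofNat w (F.degSum C j) :=
      fun m j _ hj hb => .inl (hb.eq_of_leaf hk hj)
    refine .op rfl (.op rfl ?_)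
    simp only [Function.update_self, Function.update_idem, ne_eq, not_false_eq_true,
      Function.update_of_ne, Nat.reduceEqDiff, h8, h7, h4, eval_sub (Nat.le_add_right F.len i),
      Nat.add_sub_cancel_left, eval_add, add_comm i base]
    refine .loadSmall rfl ?_ fun m' hm' => ?_
    · rw [Function.update_self, toNat_ofNat_of_lt (by omega)]
      change _ < 5 * C.n
      omega
    have hm'' := (hm.of_sumWrites hm' hb hF' hw) i (by omega)
    rw [Function.update_self, hm'']
    have hdeg : F.degSum C (F.len + i) = (F.entry i).elim 0 C.deg := by
      rw [Frontier.degSum, treeSum_leaf hk, Frontier.leafDeg, Nat.add_sub_cancel_left]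
    cases hu : F.entry i with
    | none =>
      refine .op rfl (.jumpZero_not_taken rfl ?_ (.const rfl (.jump rfl ?_)))
      · simp only [Function.update_self, ne_eq, not_false_eq_true, Function.update_of_ne,
          Nat.reduceEqDiff, h2, Frontier.encode, eval_eq_of_eq]
        exact ofNat_ne_zero one_pos (show 1 < 2 ^ w by omega)
      · refine ((hstore _ _ _ _ (by omega) hk' ?_ ?_ ?_ (hleaf _)).mono (b' := 6)
          (by omega)).weaken fun t' m'' ht' => ⟨?_, ht'.2⟩
        · simp [h6]
        · simp [h8]
        · simp [hdeg, hu]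
        · have := ht'.1
          push_cast
          linarith
    | some u =>
      have hun := hFC i (by omega) u hu
      refine .op rfl (.jumpZero_taken rfl ?_ (.op rfl (.loadLarge rfl (.op rfl (.loadLarge rfl
        (.op rfl ?_))))))
      · simp only [Function.update_self, ne_eq, not_false_eq_true, Function.update_of_ne,
          Nat.reduceEqDiff, h2, Frontier.encode]
        exact eval_eq_of_ne (ofNat_ne_allOnes (by omega))
      · refine ((hstore _ _ _ _ (by omega) hk' ?_ ?_ ?_ (hleaf _)).mono le_rfl).weaken
          fun t' m'' ht' => ⟨?_, ht'.2⟩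
        · simp [h6]
        · simp [h8]
        · simp only [Function.update_self, ne_eq, not_false_eq_true, Function.update_of_ne,
            Nat.reduceEqDiff, h3, Frontier.encode, eval_add, bfsMachine, hC.off u hun,
            hC.off_succ u hun]
          rw [eval_sub (by omega), hdeg, hu, Nat.add_sub_cancel_left]
          rfl
        · have := ht'.1
          push_cast
          linarith
  · rintro k R t m hk hk' ⟨h8, h7, h3, h2, h4, h6⟩ hm hl hr
    refine .op rfl (.loadSmall rfl ?_ fun m₁ hm₁ => .op rfl (.loadSmall rfl ?_ fun m₂ hm₂ =>
      .op rfl (.jump rfl ?_)))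
    · simp only [Function.update_self, ne_eq, not_false_eq_true, Function.update_of_ne,
            Nat.reduceEqDiff, h6, eval_add]
      rw [toNat_ofNat_of_lt (by omega)]
      change _ < 5 * C.n
      omega
    · simp only [Function.update_self, ne_eq, not_false_eq_true, Function.update_of_ne,
            Nat.reduceEqDiff, h6, h3, eval_add]
      rw [toNat_ofNat_of_lt (by omega)]
      change _ < 5 * C.n
      omega
    · refine (hstore k _ _ _ (by omega) (by omega) ?_ ?_ ?_ ?_).weaken fun t' m'' ht' => ⟨?_, ht'.2⟩
      · simp [h6]
      · simp [h8]
      · have e₁ := WriteRel.stable hm₁ (hW _ (by omega))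
          (hl (2 * k) (by omega) (by omega) ⟨0, by simp⟩)
        have e₂ := WriteRel.stable (hm₁.trans hm₂) (hW _ (by omega))
          (hr (2 * k + 1) (by omega) (by omega) ⟨0, by simp⟩)
        simp only [Function.update_self, ne_eq, not_false_eq_true, Function.update_of_ne,
            Nat.reduceEqDiff, h6, h3, eval_add, e₁, add_assoc, e₂]
        rw [Frontier.degSum, Frontier.degSum, Frontier.degSum, treeSum_node hk hk', zero_add]
      · intro j h1 h2 hb
        rcases hb.cases with rfl | hb | hb
        · exact .inl rfl
        · exact .inr (WriteRel.stable (hm₁.trans hm₂) (hW j h2) (hl j h1 h2 hb))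
        · exact .inr (WriteRel.stable (hm₁.trans hm₂) (hW j h2) (hr j h1 h2 hb))
      · have := ht'.1
        push_cast
        linarith
  · rintro k d R t m Q b hk hk' hd ⟨h8, h7, h3, h2, h4, h6⟩ - hs
    refine .jump rfl (hs _ _ _ (WriteRel.refl m) ?_ (by push_cast; linarith))
    simp [A, h7, h3, h2, h4, h6]

end Loops

/-! ### Racing claims on vertices -/

/-- The attempt of an edge `(parent, vertex)` to become a tree edge and to put `vertex` into the
next frontier at address `slot`. -/
structure Claim (w : ℕ) where
  parent : BitVec w
  vertex : BitVec w
  slot : BitVec w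

namespace Claim

variable {w : ℕ} {E : Set (Claim w)}

/-- The parent array and the slots do not overlap, and claims on a slot agree on the vertex. -/
structure Consistent (E : Set (Claim w)) : Prop where
  parent_ne : ∀ x ∈ E, x.parent ≠ .allOnes w
  slot_ne : ∀ x ∈ E, ∀ y ∈ E, x.slot ≠ y.vertex
  slot_inj : ∀ x ∈ E, ∀ y ∈ E, x.slot = y.slot → x.vertex = y.vertex

/-- Only the following has happened: vertices without a parent got one by a claim in `E`, and
vertices were put into slots by claims in `E` that determined their parents. -/
def Rel (E : Set (Claim w)) (m m' : Mem w) : Prop :=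
  ∀ a, m' a = m a ∨ (∃ x ∈ E, a = x.vertex ∧ m a = .allOnes w ∧ m' a = x.parent) ∨
    ∃ x ∈ E, a = x.slot ∧ m' a = x.vertex ∧ m' x.vertex = x.parent

theorem Rel.refl (m : Mem w) : Rel E m m := fun _ => .inl rfl

/-- Parents are written only over the largest word, and no slot coincides with an entry of the
parent array. So the first parent is final, which is also what makes `Rel` transitive. -/
theorem Rel.visited (hE : Consistent E) {m m' : Mem w} (h : Rel E m m') {y : Claim w} (hy : y ∈ E)
    (hm : m y.vertex ≠ .allOnes w) : m' y.vertex = m y.vertex := by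
  rcases h y.vertex with h | ⟨x, hx, -, e, -⟩ | ⟨x, hx, e, -⟩
  · exact h
  · exact absurd e hm
  · exact absurd e.symm (hE.slot_ne x hx y hy)

theorem Rel.trans (hE : Consistent E) {m₁ m₂ m₃ : Mem w} (h : Rel E m₁ m₂) (h' : Rel E m₂ m₃) :
    Rel E m₁ m₃ := fun a => by
  rcases h' a with e | ⟨x, hx, rfl, e₁, e₂⟩ | h'
  · rw [e]
    refine (h a).imp id (Or.imp id ?_)
    rintro ⟨x, hx, e₁, e₂, e₃⟩
    refine ⟨x, hx, e₁, e₂, ?_⟩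
    rw [h'.visited hE hx (by rw [e₃]; exact hE.parent_ne x hx), e₃]
  · refine .inr (.inl ⟨x, hx, rfl, ?_, e₂⟩)
    by_contra hne
    exact hne ((h.visited hE hx hne) ▸ e₁)
  · exact .inr (.inr h')

/-- The protocol of threads that process the claims in `E`. -/
def protocol (hE : Consistent E) : Protocol w := .uniform (Rel E) Rel.refl (Rel.trans hE)

theorem Rel.eq_of_forall_ne {m m' : Mem w} (h : Rel E m m') {a : BitVec w}
    (ha : ∀ x ∈ E, a ≠ x.vertex ∧ a ≠ x.slot) : m' a = m a := by
  rcases h a with h | ⟨x, hx, e, -⟩ | ⟨x, hx, e, -⟩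
  · exact h
  · exact absurd e (ha x hx).1
  · exact absurd e (ha x hx).2

/-- The claim `x` has been processed. -/
def Done (x : Claim w) (m : Mem w) : Prop :=
  m x.vertex ≠ .allOnes w ∧ (m x.vertex = x.parent → m x.slot = x.vertex)

/-- The parent is final by `Rel.visited`, and any later write to the slot stores the same vertex by
`slot_inj`. -/
theorem Rel.done (hE : Consistent E) {m m' : Mem w} (h : Rel E m m') {x : Claim w} (hx : x ∈ E)
    (hd : x.Done m) : x.Done m' := by
  have hv := h.visited hE hx hd.1
  refine ⟨by rw [hv]; exact hd.1, fun hp => ?_⟩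
  rw [hv] at hp
  rcases h x.slot with e | ⟨y, hy, e, -⟩ | ⟨y, hy, e, e', -⟩
  · rw [e, hd.2 hp]
  · exact absurd e (hE.slot_ne x hx y hy)
  · rw [e', hE.slot_inj x hx y hy e]

theorem Rel.cas {m : Mem w} {x : Claim w} (hx : x ∈ E) (hm : m x.vertex = .allOnes w) :
    Rel E m (Function.update m x.vertex x.parent) := fun a => by
  by_cases ha : a = x.vertex
  · exact .inr (.inl ⟨x, hx, ha, by rw [ha, hm], by rw [ha, Function.update_self]⟩)
  · exact .inl (Function.update_of_ne ha _ _)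

theorem Rel.store (hE : Consistent E) {m : Mem w} {x : Claim w} (hx : x ∈ E)
    (hm : m x.vertex = x.parent) : Rel E m (Function.update m x.slot x.vertex) := fun a => by
  by_cases ha : a = x.slot
  · exact .inr (.inr ⟨x, hx, ha, by rw [ha, Function.update_self],
      by rw [Function.update_of_ne (hE.slot_ne x hx x hx).symm, hm]⟩)
  · exact .inl (Function.update_of_ne ha _ _)

end Claim

/-! ### Slots in the next frontier -/

namespace Frontier

/-- The place in the next frontier for the target of edge `e` of entry `i` with value `u`: in a
sparse round every edge has a place of its own, in a dense round every vertex has. -/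
def place (F : Frontier) (C : Lists) (dense : Bool) (i u e : ℕ) : ℕ :=
  if dense then C.adj u e else treeOffset F.len (F.leafDeg C) (F.len + i) + e

/-- The claim of edge `e` of entry `i` with value `u`. -/
def claim (F : Frontier) (C : Lists) (w : ℕ) (dense : Bool) (next i u e : ℕ) : Claim w :=
  ⟨.ofNat w u, .ofNat w (C.adj u e), .ofNat w (next + F.place C dense i u e)⟩

/-- The claims of the edges that leave the frontier. -/
def claims (F : Frontier) (C : Lists) (w : ℕ) (dense : Bool) (next : ℕ) : Set (Claim w) :=
  {x | ∃ i < F.len, ∃ u, F.entry i = some u ∧ ∃ e < C.deg u, x = F.claim C w dense next i u e}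

variable {F : Frontier} {C : Lists} {w : ℕ} {large : Mem w} {dense : Bool} {next : ℕ}

theorem leafDeg_eq {i u : ℕ} (h : F.entry i = some u) : F.leafDeg C (F.len + i) = C.deg u := by
  rw [leafDeg, Nat.add_sub_cancel_left, h]
  rfl

theorem place_lt (hC : C.Stored large) (hFC : ∀ i < F.len, ∀ u, F.entry i = some u → u < C.n)
    (hd : dense = false → F.degSum C 1 ≤ C.n) {i u e : ℕ} (hi : i < F.len)
    (hu : F.entry i = some u) (he : e < C.deg u) : F.place C dense i u e < C.n := by
  cases dense with
  | true => exact hC.adj_lt u (hFC i hi u hu) e he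
  | false =>
    exact (treeOffset_add_lt (by omega) (by omega) (by rwa [leafDeg_eq hu])).trans_le (hd rfl)

/-- In a dense round the place is the target itself; in a sparse round the prefix sums determine the
entry and the edge from the place. -/
theorem adj_eq_of_place_eq {i u e j v f : ℕ} (hi : i < F.len)
    (hu : F.entry i = some u) (he : e < C.deg u) (hj : j < F.len) (hv : F.entry j = some v)
    (hf : f < C.deg v) (h : F.place C dense i u e = F.place C dense j v f) :
    C.adj u e = C.adj v f := by
  cases dense with
  | true => exact h
  | false =>
    obtain ⟨h1, rfl⟩ := treeOffset_add_injective (by omega) (by omega) (by rwa [leafDeg_eq hu])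
      (by omega) (by omega) (by rwa [leafDeg_eq hv]) h
    obtain rfl : i = j := by omega
    rw [hu] at hv
    cases hv
    rfl

theorem claims_consistent (hC : C.Stored large) (hw : 5 * C.n < 2 ^ w)
    (hFC : ∀ i < F.len, ∀ u, F.entry i = some u → u < C.n)
    (hd : dense = false → F.degSum C 1 ≤ C.n) (hn : C.n ≤ next) (hn' : next ≤ 2 * C.n) :
    Claim.Consistent (F.claims C w dense next) where
  parent_ne := by
    rintro _ ⟨i, hi, u, hu, e, he, rfl⟩
    have := hFC i hi u hu
    exact ofNat_ne_allOnes (by omega)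
  slot_ne := by
    rintro _ ⟨i, hi, u, hu, e, he, rfl⟩ _ ⟨j, hj, v, hv, f, hf, rfl⟩ h
    have h1 := place_lt hC hFC hd hi hu he
    have h2 := hC.adj_lt v (hFC j hj v hv) f hf
    have := (ofNat_inj (by omega) (by omega)).1 h
    omega
  slot_inj := by
    rintro _ ⟨i, hi, u, hu, e, he, rfl⟩ _ ⟨j, hj, v, hv, f, hf, rfl⟩ h
    have h1 := place_lt hC hFC hd hi hu he
    have h2 := place_lt hC hFC hd hj hv hf
    have := (ofNat_inj (by omega) (by omega)).1 h
    exact congrArg (BitVec.ofNat w) (adj_eq_of_place_eq (dense := dense) hi hu he hj hv hf (by omega))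

/-- Exploration leaves everything outside the parent array and the next frontier alone, in
particular the current frontier and the tree of sums. -/
theorem claims_untouched (hC : C.Stored large) (hw : 5 * C.n < 2 ^ w)
    (hFC : ∀ i < F.len, ∀ u, F.entry i = some u → u < C.n)
    (hd : dense = false → F.degSum C 1 ≤ C.n) (hn' : next ≤ 2 * C.n) {a : ℕ}
    (ha : C.n ≤ a) (ha' : a < next ∨ next + C.n ≤ a) (ha'' : a < 5 * C.n) :
    ∀ x ∈ F.claims C w dense next, BitVec.ofNat w a ≠ x.vertex ∧ BitVec.ofNat w a ≠ x.slot := by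
  rintro _ ⟨i, hi, u, hu, e, he, rfl⟩
  have h1 := place_lt hC hFC hd hi hu he
  have h2 := hC.adj_lt u (hFC i hi u hu) e he
  constructor
  · intro h
    have := (ofNat_inj (by omega) (by omega)).1 h
    omega
  · intro h
    have := (ofNat_inj (by omega) (by omega)).1 h
    omega

end Frontier

/-! ### Exploring the edges of a level -/

section Loops

variable {w : ℕ} {ω : ℝ} {large : Mem w} {C : Lists} {F : Frontier} {dense : Bool} {next : ℕ}

/-- The word that tells whether the round is dense. -/
def denseFlag (w : ℕ) (dense : Bool) : BitVec w := .ofNat w (if dense then 1 else 0)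

/-- One edge: claim its target. -/
theorem safe_edge (hC : C.Stored large) (hw : 5 * C.n < 2 ^ w)
    (hFC : ∀ i < F.len, ∀ u, F.entry i = some u → u < C.n)
    (hd : dense = false → F.degSum C 1 ≤ C.n) (hn' : next ≤ 2 * C.n)
    (hE : Claim.Consistent (F.claims C w dense next)) {i u e : ℕ} (hi : i < F.len)
    (hu : F.entry i = some u) (he : e < C.deg u) {R : Regs w} {t : ℝ} {m : Mem w}
    (h2 : R 2 = .allOnes w) (h5 : R 5 = .ofNat w next)
    (h8 : R 8 = .ofNat w (C.deg u + e)) (h13 : R 13 = .ofNat w u) (h14 : R 14 = .ofNat w (C.deg u))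
    (h15 : R 15 = .ofNat w (C.off u + C.n + 1 + 1))
    (h16 : R 16 = .ofNat w (next + treeOffset F.len (F.leafDeg C) (F.len + i)))
    (h21 : R 21 = denseFlag w dense) :
    Safe (bfsMachine ω large (5 * C.n)) (Claim.protocol hE)
      (fun t' m' => t' ≤ t + 11 ∧ (F.claim C w dense next i u e).Done m') 11 (.run 126 R t) m := by
  have hun := hFC i hi u hu
  have hadj := hC.adj_lt u hun e he
  have hpl := F.place_lt hC hFC hd hi hu he
  set x := F.claim C w dense next i u e with hx
  have hxE : x ∈ F.claims C w dense next := ⟨i, hi, u, hu, e, he, rfl⟩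
  have hxv : x.vertex = .ofNat w (C.adj u e) := rfl
  have hstore : ∀ (R : Regs w) (t : ℝ) (m : Mem w) pc, (∃ a, bfs[pc]? = some (.store .small a 11) ∧
      R a = x.slot) → bfs[pc + 1]? = some .halt → R 11 = x.vertex → m x.vertex = x.parent →
      Safe (bfsMachine ω large (5 * C.n)) (Claim.protocol hE)
        (fun t' m' => t' ≤ t + 2 ∧ x.Done m') 2 (.run pc R t) m := by
    rintro R t m pc ⟨a, hpc, ha⟩ hpc' h11 hm
    refine .storeSmall hpc ?_ fun m' hm' => ?_
    · rw [ha, show x.slot = .ofNat w (next + F.place C dense i u e) from rfl,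
        toNat_ofNat_of_lt (by omega)]
      change _ < 5 * C.n
      omega
    · have hv : m' x.vertex = x.parent := by
        rw [← hm]
        exact Claim.Rel.visited hE hm' hxE (by rw [hm]; exact hE.parent_ne x hxE)
      rw [ha, h11]
      refine ⟨Claim.Rel.store hE hxE hv, .halt hpc' fun m'' hm'' => ⟨by linarith, ?_⟩⟩
      refine Claim.Rel.done hE hm'' hxE ⟨?_, fun _ => Function.update_self ..⟩
      rw [Function.update_of_ne (hE.slot_ne x hxE x hxE).symm, hv]
      exact hE.parent_ne x hxE
  -- Both outcomes of the compare-and-swap lead here: all that matters afterwards is that the vertex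
  -- has some parent.
  have hcheck : ∀ (R' : Regs w) (m : Mem w), (∀ r, r ≠ 8 → r ≠ 10 → r ≠ 11 → R' r = R r) →
      R' 8 = .ofNat w e → R' 11 = x.vertex → m x.vertex ≠ .allOnes w →
      Safe (bfsMachine ω large (5 * C.n)) (Claim.protocol hE)
        (fun t' m' => t' ≤ t + 11 ∧ x.Done m') 7 (.run 130 R' (t + 4)) m := by
    intro R' m hR' h8' h11 hm
    have h13' : R' 13 = x.parent := by rw [hR' 13 (by decide) (by decide) (by decide), h13]; rfl
    have h21' : R' 21 = denseFlag w dense := by rw [hR' 21 (by decide) (by decide) (by decide), h21]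
    have h5' : R' 5 = .ofNat w next := by rw [hR' 5 (by decide) (by decide) (by decide), h5]
    have h16' := hR' 16 (by decide) (by decide) (by decide)
    rw [h16] at h16'
    refine .loadSmall rfl ?_ fun m' hm' => .op rfl ?_
    · rw [h11, hxv, toNat_ofNat_of_lt (by omega)]
      change _ < 5 * C.n
      omega
    have hv := Claim.Rel.visited hE hm' hxE hm
    simp only [Function.update_self, ne_eq, not_false_eq_true, Function.update_of_ne,
      Nat.reduceEqDiff, h11, h13', Function.update_idem]
    by_cases hp : m' x.vertex = x.parent
    · rw [eval_eq_of_eq hp]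
      refine .jumpZero_not_taken rfl ?_ ?_
      · rw [Function.update_self]
        exact ofNat_ne_zero one_pos (show 1 < 2 ^ w by omega)
      cases dense with
      | true =>
        refine .jumpZero_not_taken rfl ?_ (.op rfl ((hstore _ _ _ 135 ⟨10, rfl, ?_⟩ rfl
          ?_ hp).weaken fun t' m'' ht' => ⟨?_, ht'.2⟩))
        · rw [Function.update_of_ne (by decide), h21']
          exact ofNat_ne_zero one_pos (show 1 < 2 ^ w by omega)
        · simp only [Function.update_self, ne_eq, not_false_eq_true, Function.update_of_ne,
            Nat.reduceEqDiff, h5', h11, hxv, eval_add]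
          rfl
        · simp [h11]
        · linarith [ht'.1]
      | false =>
        refine .jumpZero_taken rfl ?_ (.op rfl ((hstore _ _ _ 138 ⟨10, rfl, ?_⟩ rfl
          ?_ hp).weaken fun t' m'' ht' => ⟨?_, ht'.2⟩))
        · rw [Function.update_of_ne (by decide), h21']
          rfl
        · simp only [Function.update_self, ne_eq, not_false_eq_true, Function.update_of_ne,
            Nat.reduceEqDiff, h16', h8', eval_add, add_assoc]
          rfl
        · simp [h11]
        · linarith [ht'.1]
    · rw [eval_eq_of_ne hp]
      refine .jumpZero_taken rfl (Function.update_self ..) (Safe.halt (b := 3) rfl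
        fun m'' hm'' => ⟨by linarith, Claim.Rel.done hE hm'' hxE ⟨by rwa [hv], fun h => absurd h hp⟩⟩)
  refine .op rfl (.op rfl (.loadLarge rfl ?_))
  simp only [Function.update_self, ne_eq, not_false_eq_true, Function.update_of_ne,
    Nat.reduceEqDiff, h8, h14, h15, eval_sub (Nat.le_add_right _ _), Nat.add_sub_cancel_left,
    eval_add, bfsMachine, hC.adj u hun e he]
  refine .casSmall rfl ?_ (fun m' hm' hmax => ?_) fun m' hm' hmax => ?_
  · rw [Function.update_self, toNat_ofNat_of_lt (by omega)]
    change _ < 5 * C.n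
    omega
  · simp only [Function.update_self, ne_eq, not_false_eq_true, Function.update_of_ne,
      Nat.reduceEqDiff, h2, h13] at hmax ⊢
    refine ⟨Claim.Rel.cas hxE hmax, ?_⟩
    rw [show t + 1 + 1 + 1 + 1 = t + 4 by ring]
    refine hcheck _ _ ?_ ?_ ?_ ?_
    · intro r h8 h10 h11
      simp [h8, h10, h11]
    · simp
    · simp [hxv]
    · rw [← hxv, Function.update_self]
      exact hE.parent_ne x hxE
  · simp only [Function.update_self, ne_eq, not_false_eq_true, Function.update_of_ne,
      Nat.reduceEqDiff, h2] at hmax ⊢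
    rw [show t + 1 + 1 + 1 + 1 = t + 4 by ring]
    refine hcheck _ _ ?_ ?_ ?_ ?_
    · intro r h8 h10 h11
      simp [h8, h10, h11]
    · simp
    · simp [hxv]
    · rwa [hxv]

/-- All edges of a vertex. -/
theorem safe_edges (hC : C.Stored large) (hw : 5 * C.n < 2 ^ w)
    (hFC : ∀ i < F.len, ∀ u, F.entry i = some u → u < C.n)
    (hd : dense = false → F.degSum C 1 ≤ C.n) (hn' : next ≤ 2 * C.n)
    (hE : Claim.Consistent (F.claims C w dense next)) {i u : ℕ} (hi : i < F.len)
    (hu : F.entry i = some u) (hpos : 0 < C.deg u) {h : ℕ} (hh : C.n ≤ 2 ^ h) {R : Regs w} {t : ℝ}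
    {m : Mem w} (h2 : R 2 = .allOnes w) (h3 : R 3 = .ofNat w 1) (h5 : R 5 = .ofNat w next)
    (h8 : R 8 = .ofNat w 1) (h13 : R 13 = .ofNat w u) (h14 : R 14 = .ofNat w (C.deg u))
    (h15 : R 15 = .ofNat w (C.off u + C.n + 1 + 1))
    (h16 : R 16 = .ofNat w (next + treeOffset F.len (F.leafDeg C) (F.len + i)))
    (h21 : R 21 = denseFlag w dense) :
    Safe (bfsMachine ω large (5 * C.n)) (Claim.protocol hE)
      (fun t' m' => t' ≤ t + ((10 * h + 13 : ℕ) : ℝ) ∧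
        ∀ e < C.deg u, (F.claim C w dense next i u e).Done m') (28 * C.deg u) (.run 118 R t) m := by
  have hun := hFC i hi u hu
  have hdn := hC.deg_le u hun
  have hxE : ∀ e < C.deg u, F.claim C w dense next i u e ∈ F.claims C w dense next :=
    fun e he => ⟨i, hi, u, hu, e, he, rfl⟩
  have key := Safe.tree (M := bfsMachine ω large (5 * C.n)) (r := Claim.Rel (F.claims C w dense next))
    (h₁ := Claim.Rel.refl) (h₂ := Claim.Rel.trans hE) (L := 118) (leaf := 126) (after := 46)
    (bound := 14) rfl rfl rfl rfl rfl rfl rfl (N := C.deg u) (by omega)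
    (A := fun k R => R 8 = .ofNat w k ∧ R 14 = .ofNat w (C.deg u) ∧ R 3 = .ofNat w 1 ∧
      R 2 = .allOnes w ∧ R 5 = .ofNat w next ∧ R 13 = .ofNat w u ∧
      R 15 = .ofNat w (C.off u + C.n + 1 + 1) ∧
      R 16 = .ofNat w (next + treeOffset F.len (F.leafDeg C) (F.len + i)) ∧
      R 21 = denseFlag w dense)
    (fun k R hR => ⟨hR.1, hR.2.1, hR.2.2.1⟩) (I := fun _ => True) (fun _ _ _ _ => trivial)
    (post := fun k m => ∀ e < C.deg u, IsBelow k (C.deg u + e) →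
      (F.claim C w dense next i u e).Done m)
    (cl := 11) (ca := 1) (ct := 1) (g := fun _ => 11) ?_ ?_ ?_ h (k := 1) one_pos (by omega)
    (by omega) ⟨h8, h14, h3, h2, h5, h13, h15, h16, h21⟩ trivial (t := t) (m := m)
  · refine (key.mono ?_).weaken fun t' m' ht' => ⟨?_, fun i hi => ht'.2 i hi (isBelow_one (by omega))⟩
    · rw [treeSum_one hpos, Finset.sum_const, Finset.card_range, smul_eq_mul]
      omega
    · have := ht'.1
      push_cast at *
      linarith
  · rintro k R t m hk hk' ⟨h8, h14, h3, h2, h5, h13, h15, h16, h21⟩ -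
    obtain ⟨e, rfl⟩ := Nat.exists_eq_add_of_le hk
    refine (safe_edge hC hw hFC hd hn' hE hi hu (e := e) (by omega) ?_ ?_ ?_ ?_ ?_ ?_ ?_ ?_).weaken
      fun t' m' ht' => ⟨?_, fun f hf hb => ?_⟩
    · simp [h2]
    · simp [h5]
    · simp [h8]
    · simp [h13]
    · simp [h14]
    · simp [h15]
    · simp [h16]
    · simp [h21]
    · exact ht'.1
    · have := hb.eq_of_leaf hk (by omega)
      obtain rfl : f = e := by omega
      exact ht'.2
  · rintro k R t m hk hk' - - hl hr
    refine .halt rfl fun m' hm' => ⟨by push_cast; linarith, fun e he hb => ?_⟩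
    rcases hb.cases with rfl | hb | hb
    · omega
    · exact Claim.Rel.done hE hm' (hxE e he) (hl e he hb)
    · exact Claim.Rel.done hE hm' (hxE e he) (hr e he hb)
  · rintro k d R t m Q b hk hk' hd ⟨h8, h14, h3, h2, h5, h13, h15, h16, h21⟩ - hs
    refine .jump rfl (hs _ _ _ (Claim.Rel.refl m) ?_ (by push_cast; linarith))
    simp [h14, h3, h2, h5, h13, h15, h16, h21]

/-- All edges that leave the frontier. -/
theorem safe_explore (hC : C.Stored large) (hw : 5 * C.n < 2 ^ w) (hF : 0 < F.len)
    (hF' : F.len ≤ C.n) (hFC : ∀ i < F.len, ∀ u, F.entry i = some u → u < C.n)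
    (hd : dense = false → F.degSum C 1 ≤ C.n) (hn' : next ≤ 2 * C.n) {base : ℕ}
    (hb : C.n ≤ base) (hb' : base + C.n ≤ next ∨ next + C.n ≤ base) (hb'' : base ≤ 2 * C.n)
    (hE : Claim.Consistent (F.claims C w dense next)) {h : ℕ} (hh : C.n ≤ 2 ^ h) {R : Regs w}
    {t : ℝ} {m : Mem w} (hm : F.Stored base m) (hT : F.SumsStored C m)
    (h1 : R 1 = .ofNat w C.n) (h2 : R 2 = .allOnes w) (h3 : R 3 = .ofNat w 1)
    (h4 : R 4 = .ofNat w base) (h5 : R 5 = .ofNat w next) (h6 : R 6 = .ofNat w (3 * C.n))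
    (h7 : R 7 = .ofNat w F.len) (h8 : R 8 = .ofNat w 1) (h12 : R 12 = .ofNat w 0)
    (h21 : R 21 = denseFlag w dense) :
    Safe (bfsMachine ω large (5 * C.n)) (Claim.protocol hE)
      (fun t' m' => t' ≤ t + ((25 * h + 31 : ℕ) : ℝ) ∧
        ∀ x ∈ F.claims C w dense next, x.Done m') (44 * F.len + 28 * F.degSum C 1)
      (.run 88 R t) m := by
  -- The data that the loop reads to find its way is untouched by the concurrent claims.
  have hI : ∀ m m', F.Stored base m ∧ F.SumsStored C m → Claim.Rel (F.claims C w dense next) m m' →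
      F.Stored base m' ∧ F.SumsStored C m' := by
    rintro m m' ⟨ha, hb⟩ hr
    refine ⟨fun i hi => ?_, fun k hk hk' => ?_⟩
    · rw [hr.eq_of_forall_ne (F.claims_untouched hC hw hFC hd hn' (by omega) (by omega)
        (by omega)), ha i hi]
    · rw [hr.eq_of_forall_ne (F.claims_untouched hC hw hFC hd hn' (by omega) (by omega)
        (by omega)), hb k hk hk']
  have key := Safe.tree (M := bfsMachine ω large (5 * C.n)) (r := Claim.Rel (F.claims C w dense next))
    (h₁ := Claim.Rel.refl) (h₂ := Claim.Rel.trans hE) (L := 88) (leaf := 101) (after := 46)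
    (bound := 7) rfl rfl rfl rfl rfl rfl rfl (N := F.len) (by omega)
    (A := fun k R => R 8 = .ofNat w k ∧ R 7 = .ofNat w F.len ∧ R 3 = .ofNat w 1 ∧
      R 2 = .allOnes w ∧ R 5 = .ofNat w next ∧ R 1 = .ofNat w C.n ∧
      R 4 = .ofNat w base ∧ R 6 = .ofNat w (3 * C.n) ∧
      R 12 = .ofNat w (treeOffset F.len (F.leafDeg C) k) ∧ R 21 = denseFlag w dense)
    (fun k R hR => ⟨hR.1, hR.2.1, hR.2.2.1⟩) (I := fun m => F.Stored base m ∧ F.SumsStored C m) hI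
    (post := fun k m => ∀ i < F.len, IsBelow k (F.len + i) → ∀ u, F.entry i = some u →
      ∀ e < C.deg u, (F.claim C w dense next i u e).Done m)
    -- A leaf is itself a loop over a vertex's edges: 16 instructions of set-up and then depth `10 *
    -- h + 13`. The two loops add up to `15 * h + 10 * h`.
    (cl := 10 * h + 29) (ca := 1) (ct := 6) (g := fun k => 17 + 28 * F.leafDeg C k) ?_ ?_ ?_ h
    (k := 1) one_pos (by omega) (by omega)
    ⟨h8, h7, h3, h2, h5, h1, h4, h6, by rw [treeOffset_one, h12], h21⟩ ⟨hm, hT⟩ (t := t) (m := m)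
  · refine (key.mono ?_).weaken fun t' m' ht' => ⟨?_, ?_⟩
    · rw [treeSum_one hF, Frontier.degSum, treeSum_one hF, Finset.sum_add_distrib,
        Finset.sum_add_distrib, Finset.sum_const, Finset.sum_const, Finset.card_range,
        ← Finset.mul_sum]
      simp only [smul_eq_mul]
      omega
    · have := ht'.1
      push_cast at *
      linarith
    · rintro _ ⟨i, hi, u, hu, e, he, rfl⟩
      exact ht'.2 i hi (isBelow_one (by omega)) u hu e he
  · rintro k R t m hk hk' ⟨h8, h7, h3, h2, h5, h1, h4, h6, h12, h21⟩ hm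
    obtain ⟨i, rfl⟩ := Nat.exists_eq_add_of_le hk
    have h10 : (0 : ℝ) ≤ 10 * h := by positivity
    refine .mono (b := 16 + 28 * F.leafDeg C (F.len + i) + 1) ?_ (by omega)
    rw [show 16 + 28 * F.leafDeg C (F.len + i) + 1 = 12 + 28 * F.leafDeg C (F.len + i) + 5 by ring]
    refine .op rfl (.op rfl ?_)
    simp only [Function.update_self, Function.update_idem, ne_eq, not_false_eq_true,
      Function.update_of_ne, Nat.reduceEqDiff, h8, h7, h4, eval_sub (Nat.le_add_right F.len i),
      Nat.add_sub_cancel_left, eval_add, add_comm i base]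
    refine .loadSmall rfl ?_ fun m' hm' => ?_
    · rw [Function.update_self, toNat_ofNat_of_lt (by omega)]
      change _ < 5 * C.n
      omega
    rw [Function.update_self, (hI _ _ hm hm').1 i (by omega)]
    cases hu : F.entry i with
    | none =>
      refine .op rfl (.jumpZero_not_taken rfl ?_ ?_)
      · simp only [Function.update_self, ne_eq, not_false_eq_true, Function.update_of_ne,
          Nat.reduceEqDiff, h2, Frontier.encode, eval_eq_of_eq]
        exact ofNat_ne_zero one_pos (show 1 < 2 ^ w by omega)
      · rw [show 12 + 28 * F.leafDeg C (F.len + i) = 11 + 28 * F.leafDeg C (F.len + i) + 1 by ring]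
        refine .halt rfl fun m'' _ => ⟨by push_cast; linarith, fun j hj hb u hu' => ?_⟩
        have := hb.eq_of_leaf hk (by omega)
        obtain rfl : j = i := by omega
        rw [hu] at hu'
        cases hu'
    | some u =>
      have hun := hFC i (by omega) u hu
      have hpost : ∀ m, (∀ e < C.deg u, (F.claim C w dense next i u e).Done m) →
          ∀ j < F.len, IsBelow (F.len + i) (F.len + j) → ∀ u, F.entry j = some u →
            ∀ e < C.deg u, (F.claim C w dense next j u e).Done m := by
        intro m hm j hj hb v hv
        have := hb.eq_of_leaf hk (by omega)
        obtain rfl : j = i := by omega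
        rw [hu] at hv
        cases hv
        exact hm
      rw [F.leafDeg_eq hu, show 12 + 28 * C.deg u = 6 + 28 * C.deg u + 1 + 5 by ring]
      refine .op rfl (.jumpZero_taken rfl ?_ ?_)
      · simp only [Function.update_self, ne_eq, not_false_eq_true, Function.update_of_ne,
          Nat.reduceEqDiff, h2, Frontier.encode]
        exact eval_eq_of_ne (ofNat_ne_allOnes (by omega))
      refine .op rfl (.loadLarge rfl (.op rfl (.loadLarge rfl (.op rfl ?_))))
      simp only [Function.update_self, ne_eq, not_false_eq_true, Function.update_of_ne,
        Nat.reduceEqDiff, h3, Frontier.encode, eval_add, bfsMachine, hC.off u hun,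
        hC.off_succ u hun]
      rw [eval_sub (by omega), Nat.add_sub_cancel_left]
      by_cases hpos : 0 < C.deg u
      · rw [show 6 + 28 * C.deg u + 1 = 28 * C.deg u + 1 + 6 by ring]
        refine .jumpZero_not_taken rfl ?_ (.op rfl (.op rfl (.op rfl (.op rfl (.const rfl ?_)))))
        · rw [Function.update_self]
          exact ofNat_ne_zero hpos (by have := hC.deg_le u hun; omega)
        · refine ((safe_edges hC hw hFC hd hn' hE (i := i) (by omega) hu hpos hh ?_ ?_ ?_ ?_ ?_ ?_ ?_
            ?_ ?_).mono (Nat.le_succ _)).weaken fun t' m'' ht' => ⟨?_, hpost m'' ht'.2⟩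
          · simp [h2]
          · simp [h3]
          · simp [h5]
          · simp
          · simp
          · simp
          · simp only [Function.update_self, ne_eq, not_false_eq_true, Function.update_of_ne,
              Nat.reduceEqDiff, h3, h1, eval_add]
          · simp only [Function.update_self, ne_eq, not_false_eq_true, Function.update_of_ne,
              Nat.reduceEqDiff, h5, h12, eval_add]
          · simp [h21]
          · have := ht'.1
            push_cast at *
            linarith
      · rw [not_lt, Nat.le_zero] at hpos
        rw [show 6 + 28 * C.deg u + 1 = 5 + 28 * C.deg u + 1 + 1 by ring]
        refine .jumpZero_taken rfl ?_ (.halt rfl fun m'' _ => ⟨by push_cast; linarith,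
          hpost m'' fun e he => by omega⟩)
        rw [Function.update_self, hpos]
        rfl
  · rintro k R t m hk hk' - - hl hr
    have hxE : ∀ i < F.len, ∀ u, F.entry i = some u → ∀ e < C.deg u,
      F.claim C w dense next i u e ∈ F.claims C w dense next :=
      fun i hi u hu e he => ⟨i, hi, u, hu, e, he, rfl⟩
    refine .halt rfl fun m' hm' => ⟨by push_cast; linarith, fun i hi hb u hu e he => ?_⟩
    rcases hb.cases with rfl | hb | hb
    · omega
    · exact Claim.Rel.done hE hm' (hxE i hi u hu e he) (hl i hi hb u hu e he)
    · exact Claim.Rel.done hE hm' (hxE i hi u hu e he) (hr i hi hb u hu e he)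
  · rintro k d R t m Q b hk hk' hd' ⟨h8, h7, h3, h2, h5, h1, h4, h6, h12, h21⟩ ⟨-, hT⟩ hs
    obtain rfl | rfl : d = 0 ∨ d = 1 := by omega
    · refine .mono (b := b + 1 + 1) (.op rfl (.jumpZero_taken rfl ?_ (hs _ _ _ (Claim.Rel.refl m) ?_
        (by push_cast; linarith)))) (by omega)
      · simp [h3, BinOp.eval]
      · simp [h7, h3, h2, h5, h1, h4, h6, h12, h21, treeOffset_left hk]
    · refine .op rfl (.jumpZero_not_taken rfl ?_ (.op rfl (.loadSmall rfl ?_ fun m' hm' => .op rfl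
        (.jump rfl (hs _ _ _ hm' ?_ (by push_cast; linarith))))))
      · simp only [Function.update_self, ne_eq, not_false_eq_true, Function.update_of_ne,
          Nat.reduceEqDiff, h3]
        rw [eval_sub (by omega)]
        exact ofNat_ne_zero (by omega) (by omega)
      · simp only [Function.update_self, ne_eq, not_false_eq_true, Function.update_of_ne,
          Nat.reduceEqDiff, h6, eval_add]
        rw [toNat_ofNat_of_lt (by omega)]
        change _ < 5 * C.n
        omega
      -- The offset of the right child needs the sum stored at its left sibling, which no claim has
      -- altered.
      · have e := hT (2 * k) (by omega) (by omega)
        rw [← hm'.eq_of_forall_ne (F.claims_untouched hC hw hFC hd hn' (by omega) (by omega)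
          (by omega))] at e
        simp only [Function.update_self, ne_eq, not_false_eq_true, Function.update_of_ne,
          Nat.reduceEqDiff, h7, h3, h2, h5, h1, h4, h6, h12, h21, eval_add, e, Frontier.degSum,
          treeOffset_right hk, and_self]

end Loops

/-! ### Adjacency lists from the compressed format -/

section CSR

variable {n w : ℕ} {G : SimpleGraph (Fin n)} {large : Mem w}

theorem ofNat_word (M : Mem w) (i : ℕ) : BitVec.ofNat w (word M i) = M (.ofNat w i) := by
  simp [word]

/-- The adjacency lists of a graph in compressed sparse row format. -/
def csrLists (n : ℕ) (large : Mem w) : Lists where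
  n := n
  off u := word large (1 + u)
  deg u := word large (2 + u) - word large (1 + u)
  adj u e := word large (n + 2 + (word large (1 + u) + e))

theorem csrLists_adj (h : IsCSR G large) {u v : Fin n} :
    G.Adj u v ↔ ∃ e < (csrLists n large).deg u, (csrLists n large).adj u e = v := by
  have hb := h.adjacency u
  have hm := h.offset_mono u
  constructor
  · intro huv
    obtain ⟨j, ⟨h1, h2⟩, h3⟩ := hb.surjOn ⟨v, huv, rfl⟩
    refine ⟨j - word large (1 + u), ?_, ?_⟩
    · simp only [csrLists]
      omega
    · simp only [csrLists]
      rw [Nat.add_sub_cancel' h1]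
      exact h3
  · rintro ⟨e, he, hv⟩
    simp only [csrLists] at he hv
    obtain ⟨v', hv', e'⟩ := hb.mapsTo (x := word large (1 + u) + e) ⟨by omega, by omega⟩
    have : v' = v := Fin.ext (e'.trans hv)
    exact this ▸ hv'

theorem csrLists_adj_lt (h : IsCSR G large) {u : ℕ} (hu : u < n) {e : ℕ}
    (he : e < (csrLists n large).deg u) : (csrLists n large).adj u e < n := by
  have hm := h.offset_mono ⟨u, hu⟩
  simp only [csrLists] at he hm
  obtain ⟨v', -, e'⟩ := (h.adjacency ⟨u, hu⟩).mapsTo (x := word large (1 + u) + e)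
    ⟨by simp, by simp only; omega⟩
  exact e'.symm.trans_lt v'.2

theorem csrLists_adj_inj (h : IsCSR G large) {u : ℕ} (hu : u < n) {e f : ℕ}
    (he : e < (csrLists n large).deg u) (hf : f < (csrLists n large).deg u)
    (hef : (csrLists n large).adj u e = (csrLists n large).adj u f) : e = f := by
  have hm := h.offset_mono ⟨u, hu⟩
  simp only [csrLists] at he hf hm
  have := (h.adjacency ⟨u, hu⟩).injOn (x₁ := word large (1 + u) + e) ⟨by simp, by simp only; omega⟩
    (x₂ := word large (1 + u) + f) ⟨by simp, by simp only; omega⟩ hef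
  omega

theorem csrLists_deg (h : IsCSR G large) (u : Fin n) :
    (csrLists n large).deg u = (G.neighborSet u).ncard := by
  have hb := h.adjacency u
  have h1 := hb.image_eq
  have h2 := hb.injOn.ncard_image
  rw [h1, Set.ncard_image_of_injective _ Fin.val_injective] at h2
  rw [h2, ← Finset.coe_Ico, Set.ncard_coe_finset, Nat.card_Ico]
  rfl

theorem csrLists_stored (h : IsCSR G large) : (csrLists n large).Stored large where
  size := by rw [← ofNat_word large, h.size]; rfl
  off u hu := by rw [← ofNat_word large, add_comm u 1]; rfl
  off_succ u hu := by
    have hm := h.offset_mono ⟨u, hu⟩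
    simp only [csrLists] at hm ⊢
    rw [← ofNat_word large, show u + 1 + 1 = 2 + u by ring]
    congr 1
    omega
  adj u hu e he := by
    simp only [csrLists]
    rw [ofNat_word]
    congr 2
    ring
  adj_lt u hu e he := csrLists_adj_lt h hu he
  deg_le u hu := by
    rw [csrLists_deg h ⟨u, hu⟩]
    exact (Set.ncard_le_card _).trans_eq (Nat.card_fin n)

theorem sum_deg (h : IsCSR G large) : ∑ u : Fin n, (csrLists n large).deg u = 2 * edgeCount G := by
  classical
  rw [edgeCount, ← SimpleGraph.coe_edgeFinset, Set.ncard_coe_finset,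
    ← SimpleGraph.sum_degrees_eq_twice_card_edges]
  refine Finset.sum_congr rfl fun u _ => ?_
  rw [csrLists_deg h, ← SimpleGraph.card_neighborSet_eq_degree, Set.ncard_eq_toFinset_card',
    Set.toFinset_card]

end CSR

/-! ### Distance levels of a graph -/

section Levels

variable {n : ℕ} {G : SimpleGraph (Fin n)} {s : Fin n}

/-- The vertex `v` is reachable from `s` and has distance `i`. -/
def AtLevel (G : SimpleGraph (Fin n)) (s : Fin n) (i : ℕ) (v : Fin n) : Prop :=
  G.Reachable s v ∧ G.dist s v = i

theorem AtLevel.exists_pred {i : ℕ} {v : Fin n} (h : AtLevel G s (i + 1) v) :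
    ∃ u, G.Adj u v ∧ AtLevel G s i u := by
  obtain ⟨p, hp⟩ := h.1.exists_walk_length_eq_dist
  rw [h.2] at hp
  have hnil : ¬ p.Nil := fun hn => by
    have := SimpleGraph.Walk.length_eq_zero_iff.2 hn
    omega
  refine ⟨p.penultimate, p.adj_penultimate hnil, p.dropLast.reachable, ?_⟩
  have h1 : G.dist s p.penultimate ≤ i := by
    refine (SimpleGraph.dist_le p.dropLast).trans ?_
    have := SimpleGraph.Walk.length_dropLast_add_one hnil
    omega
  have h2 : G.dist s v ≤ G.dist s p.penultimate + 1 := by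
    obtain ⟨q, hq⟩ := p.dropLast.reachable.exists_walk_length_eq_dist
    refine (SimpleGraph.dist_le (q.concat (p.adj_penultimate hnil))).trans ?_
    rw [SimpleGraph.Walk.length_concat, hq]
  have := h.2
  omega

theorem AtLevel.adj {i : ℕ} {u v : Fin n} (h : AtLevel G s i u) (huv : G.Adj u v) :
    G.Reachable s v ∧ G.dist s v ≤ i + 1 := by
  obtain ⟨q, hq⟩ := h.1.exists_walk_length_eq_dist
  refine ⟨h.1.trans huv.reachable, (SimpleGraph.dist_le (q.concat huv)).trans ?_⟩
  rw [SimpleGraph.Walk.length_concat, hq, h.2]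

/-- A vertex of level `i + 1` has a neighbour in level `i`, so that level is empty, and then so are
all later ones. This justifies stopping when the degree sum is zero. -/
theorem dist_le_of_forall_not_adj {i : ℕ} (h : ∀ u v, AtLevel G s i u → ¬ G.Adj u v) {v : Fin n}
    (hv : G.Reachable s v) : G.dist s v ≤ i := by
  have key : ∀ d v, ¬ AtLevel G s (i + 1 + d) v := by
    intro d
    induction d with
    | zero =>
      intro v hv
      obtain ⟨u, huv, hu⟩ := hv.exists_pred
      exact h u v hu huv
    | succ d ih =>
      intro v hv
      obtain ⟨u, -, hu⟩ := AtLevel.exists_pred (i := i + 1 + d) hv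
      exact ih u hu
  by_contra hlt
  exact key (G.dist s v - (i + 1)) v ⟨hv, by omega⟩

theorem AtLevel.le_diameter {i : ℕ} {v : Fin n} (h : AtLevel G s i v) : i ≤ diameter G := by
  rw [← h.2]
  exact Finset.le_sup (f := fun p : Fin n × Fin n => G.dist p.1 p.2) (Finset.mem_univ (s, v))

theorem atLevel_zero {v : Fin n} : AtLevel G s 0 v ↔ v = s := by
  constructor
  · rintro ⟨h1, h2⟩
    exact (h1.dist_eq_zero_iff.1 h2).symm
  · rintro rfl
    exact ⟨.rfl, SimpleGraph.dist_self⟩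

end Levels

/-! ### The invariant of the search and its preservation -/

/-- The state of the search when level `i` is the frontier: the frontier `F` contains exactly the
vertices of level `i`, each of them once, and the vertices up to level `i`, but no others, have a
parent. -/
structure SearchState {n w : ℕ} (G : SimpleGraph (Fin n)) (s : Fin n) (i : ℕ) (F : Frontier)
    (m : Mem w) : Prop where
  len_pos : 0 < F.len
  len_le : F.len ≤ n
  entry : ∀ j < F.len, ∀ u, F.entry j = some u → ∃ v : Fin n, (v : ℕ) = u ∧ AtLevel G s i v
  entry_surj : ∀ v : Fin n, AtLevel G s i v → ∃ j < F.len, F.entry j = some (v : ℕ)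
  entry_inj : ∀ j < F.len, ∀ j' < F.len, ∀ u, F.entry j = some u → F.entry j' = some u → j = j'
  root : m (.ofNat w s) = .ofNat w s
  parent : ∀ v : Fin n, v ≠ s → G.Reachable s v → G.dist s v ≤ i →
    ∃ u : Fin n, m (.ofNat w v) = .ofNat w u ∧ G.Adj u v ∧ G.dist s v = G.dist s u + 1
  unvisited : ∀ v : Fin n, ¬ (G.Reachable s v ∧ G.dist s v ≤ i) → m (.ofNat w v) = .allOnes w

namespace SearchState

variable {n w : ℕ} {G : SimpleGraph (Fin n)} {s : Fin n} {i : ℕ} {F : Frontier} {m m' : Mem w}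

theorem congr (h : SearchState G s i F m)
    (hm : ∀ v < n, m' (.ofNat w v) = m (.ofNat w v)) : SearchState G s i F m' where
  __ := h
  root := by rw [hm s s.2, h.root]
  parent v := by rw [hm v v.2]; exact h.parent v
  unvisited v := by rw [hm v v.2]; exact h.unvisited v

theorem entry_lt (h : SearchState G s i F m) {j : ℕ} (hj : j < F.len) {u : ℕ}
    (hu : F.entry j = some u) : u < n := by
  obtain ⟨v, rfl, -⟩ := h.entry j hj u hu
  exact v.2

theorem visited_ne (h : SearchState G s i F m) (hw : 5 * n < 2 ^ w) {v : Fin n}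
    (hv : G.Reachable s v) (hv' : G.dist s v ≤ i) : m (.ofNat w v) ≠ .allOnes w := by
  by_cases hs : v = s
  · subst hs
    rw [h.root]
    exact ofNat_ne_allOnes (by omega)
  · obtain ⟨u, hu, -⟩ := h.parent v hs hv hv'
    rw [hu]
    exact ofNat_ne_allOnes (by omega)

/-- If the vertices of the frontier have no neighbours, then the search is complete. -/
theorem isBFSTree (h : SearchState G s i F m) (hw : 5 * n < 2 ^ w)
    (hadj : ∀ u v, AtLevel G s i u → ¬ G.Adj u v) : IsBFSTree G s m where
  root := by rw [word, h.root, toNat_ofNat_of_lt (by omega)]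
  parent v hv hr := by
    obtain ⟨u, h1, h2⟩ := h.parent v hv hr (dist_le_of_forall_not_adj hadj hr)
    exact ⟨u, by rw [word, h1, toNat_ofNat_of_lt (by omega)], h2⟩
  unreachable v hv := h.unvisited v fun hr => hv hr.1

/-- The sum of the degrees of the vertices of a level. -/
theorem degSum_one (h : SearchState G s i F m) (C : Lists) [DecidablePred (AtLevel G s i)] :
    F.degSum C 1 = ∑ v with AtLevel G s i v, C.deg v := by
  classical
  have h1 : F.degSum C 1 = ∑ j ∈ Finset.range F.len, (F.entry j).elim 0 C.deg := by
    rw [Frontier.degSum, treeSum_one h.len_pos, zero_mul, zero_add]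
    exact Finset.sum_congr rfl fun j _ => by rw [Frontier.leafDeg, Nat.add_sub_cancel_left]
  -- Writing each entry as a sum over vertices permits exchanging the two sums; then `entry_surj`
  -- and `entry_inj` count each vertex of the level exactly once.
  have h2 : ∀ j ∈ Finset.range F.len, (F.entry j).elim 0 C.deg =
      ∑ v : Fin n, if F.entry j = some (v : ℕ) then C.deg v else 0 := by
    intro j hj
    cases hu : F.entry j with
    | none => simp
    | some u =>
      obtain ⟨v, rfl, -⟩ := h.entry j (Finset.mem_range.1 hj) u hu
      rw [Finset.sum_eq_single v] <;> simp +contextual [Fin.ext_iff, eq_comm]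
  rw [h1, Finset.sum_congr rfl h2, Finset.sum_comm, Finset.sum_filter]
  refine Finset.sum_congr rfl fun v _ => ?_
  split_ifs with hv
  · obtain ⟨j, hj, e⟩ := h.entry_surj v hv
    rw [Finset.sum_eq_single j, if_pos e]
    · intro j' hj' hne
      exact if_neg fun e' => hne (h.entry_inj j' (Finset.mem_range.1 hj') j hj v e' e)
    · intro hj'
      exact absurd (Finset.mem_range.2 hj) hj'
  · refine Finset.sum_eq_zero fun j hj => if_neg fun e => hv ?_
    obtain ⟨v', e', hv'⟩ := h.entry j (Finset.mem_range.1 hj) v e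
    exact Fin.ext e' ▸ hv'

end SearchState

/-- The frontier that is stored from address `base` on. -/
def Frontier.ofMem {w : ℕ} (m : Mem w) (base len : ℕ) : Frontier where
  len := len
  entry j := if m (.ofNat w (base + j)) = .allOnes w then none else
    some (m (.ofNat w (base + j))).toNat

theorem Frontier.ofMem_stored {w : ℕ} (m : Mem w) (base len : ℕ) :
    (Frontier.ofMem m base len).Stored base m := fun j _ => by
  simp only [Frontier.ofMem]
  split_ifs with h
  · rw [h]; rfl
  · simp [Frontier.encode]

/-- After all claims of the edges that leave level `i` have been processed, level `i + 1` is the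
frontier. -/
theorem SearchState.next {n w : ℕ} {G : SimpleGraph (Fin n)} {s : Fin n} {i : ℕ} {F : Frontier}
    {large m m' : Mem w} (hG : IsCSR G large) (hw : 5 * n < 2 ^ w) {dense : Bool} {next len : ℕ}
    (hn : n ≤ next) (hn' : next ≤ 2 * n)
    (hd : dense = false → F.degSum (csrLists n large) 1 ≤ n)
    (hlen : len = if dense then n else F.degSum (csrLists n large) 1) (hlen' : 0 < len)
    (h : SearchState G s i F m) (hfill : ∀ j < len, m (.ofNat w (next + j)) = .allOnes w)
    (hr : Claim.Rel (F.claims (csrLists n large) w dense next) m m')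
    (hdone : ∀ x ∈ F.claims (csrLists n large) w dense next, x.Done m') :
    SearchState G s (i + 1) (Frontier.ofMem m' next len) m' := by
  set C := csrLists n large with hCdef
  have hC : C.Stored large := csrLists_stored hG
  have hFC : ∀ i < F.len, ∀ u, F.entry i = some u → u < C.n := fun j hj u hu => h.entry_lt hj hu
  have hE : Claim.Consistent (F.claims C w dense next) :=
    F.claims_consistent hC hw hFC hd hn hn'
  have hlen_le : len ≤ n := by
    rw [hlen]
    split_ifs with hdense
    · exact le_rfl
    · exact hd (by simpa using hdense)
  have hclaim : ∀ x ∈ F.claims C w dense next, ∃ j < F.len, ∃ u v : Fin n, ∃ e < C.deg u,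
      F.entry j = some (u : ℕ) ∧ AtLevel G s i u ∧ C.adj u e = v ∧ G.Adj u v ∧
        F.place C dense j u e < len ∧ x = F.claim C w dense next j u e ∧
        x.parent = .ofNat w u ∧ x.vertex = .ofNat w v := by
    rintro _ ⟨j, hj, u, hu, e, he, rfl⟩
    obtain ⟨u, rfl, hl⟩ := h.entry j hj u hu
    have hv := csrLists_adj_lt hG u.2 he
    refine ⟨j, hj, u, ⟨_, hv⟩, e, he, hu, hl, rfl, (csrLists_adj hG).2 ⟨e, he, rfl⟩, ?_, rfl, rfl, rfl⟩
    rw [hlen]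
    cases hdense : dense with
    | true => exact hv
    | false =>
      exact treeOffset_add_lt (by omega) (by omega) (by rwa [F.leafDeg_eq hu])
  have hinj : ∀ u v : Fin n, BitVec.ofNat w u = BitVec.ofNat w v → u = v := fun u v e =>
    Fin.ext ((ofNat_inj (by omega) (by omega)).1 e)
  -- Slots start at `next ≥ n`, so an entry of the parent array changes only by gaining a parent in
  -- level `i`.
  have hparent : ∀ v : Fin n, m' (.ofNat w v) = m (.ofNat w v) ∨
      (m (.ofNat w v) = .allOnes w ∧ ∃ u, AtLevel G s i u ∧ G.Adj u v ∧
        m' (.ofNat w v) = .ofNat w u) := by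
    intro v
    rcases hr (.ofNat w v) with e | ⟨x, hx, e, e', e''⟩ | ⟨x, hx, e, -⟩
    · exact .inl e
    · obtain ⟨j, hj, u, v', f, hf, hu, hl, ha, hadj, hp, -, hxp, hxv⟩ := hclaim x hx
      rw [hxv] at e
      obtain rfl := hinj _ _ e
      exact .inr ⟨e', u, hl, hadj, e''.trans hxp⟩
    · obtain ⟨j, hj, u, v', f, hf, hu, hl, ha, hadj, hp, rfl, -⟩ := hclaim x hx
      have := (ofNat_inj (by omega) (by omega)).1 e
      omega
  have hold : ∀ v : Fin n, G.Reachable s v → G.dist s v ≤ i →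
      m' (.ofNat w v) = m (.ofNat w v) := by
    intro v h1 h2
    rcases hparent v with e | ⟨e, -⟩
    · exact e
    · exact absurd e (h.visited_ne hw h1 h2)
  have hnew : ∀ v : Fin n, AtLevel G s (i + 1) v → ∃ u, AtLevel G s i u ∧ G.Adj u v ∧
      m' (.ofNat w v) = .ofNat w u := by
    intro v hv
    obtain ⟨u, huv, hu⟩ := hv.exists_pred
    obtain ⟨j, hj, hju⟩ := h.entry_surj u hu
    obtain ⟨e, he, hev⟩ := (csrLists_adj hG).1 huv
    have hx := hdone _ ⟨j, hj, u, hju, e, he, rfl⟩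
    have hne : m' (.ofNat w v) ≠ .allOnes w := by
      have := hx.1
      rwa [show (F.claim C w dense next j u e).vertex = .ofNat w v from
        congrArg (BitVec.ofNat w) hev] at this
    rcases hparent v with e | ⟨-, h⟩
    · rw [e] at hne
      exact absurd (h.unvisited v fun h' => by have := hv.2; omega) hne
    · exact h
  have hslot : ∀ j < len, m' (.ofNat w (next + j)) ≠ .allOnes w →
      ∃ x ∈ F.claims C w dense next, x.slot = .ofNat w (next + j) ∧
        m' (.ofNat w (next + j)) = x.vertex ∧ m' x.vertex = x.parent := by
    intro j hj hne
    rcases hr (.ofNat w (next + j)) with e | ⟨x, hx, e, -⟩ | ⟨x, hx, e, e'⟩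
    · rw [hfill j hj] at e
      exact absurd e hne
    · obtain ⟨j, hj, u, v', f, hf, hu, hl, ha, hadj, hp, -, hxp, hxv⟩ := hclaim x hx
      rw [hxv] at e
      have := (ofNat_inj (by omega) (by omega)).1 e
      omega
    · exact ⟨x, hx, e.symm, e'⟩
  have hentry : ∀ j < len, ∀ v, (Frontier.ofMem m' next len).entry j = some v →
      ∃ x ∈ F.claims C w dense next, x.slot = .ofNat w (next + j) ∧
        x.vertex = .ofNat w v ∧ m' x.vertex = x.parent := by
    intro j hj v hv
    simp only [Frontier.ofMem] at hv
    split_ifs at hv with hne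
    obtain ⟨x, hx, h1, h2, h3⟩ := hslot j hj hne
    refine ⟨x, hx, h1, ?_, h3⟩
    rw [← h2, ← Option.some_inj.1 hv]
    simp
  refine ⟨hlen', hlen_le, ?_, ?_, ?_, ?_, ?_, ?_⟩
  · intro j hj v hv
    obtain ⟨x, hx, -, h2, h3⟩ := hentry j hj v hv
    obtain ⟨j', hj', u, v', f, hf, hu, hl, ha, hadj, hp, rfl, hxp, hxv⟩ := hclaim x hx
    have hvw : v < 2 ^ w := by
      simp only [Frontier.ofMem] at hv
      split_ifs at hv
      rw [← Option.some_inj.1 hv]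
      exact BitVec.isLt _
    rw [hxv] at h2 h3
    rw [hxp] at h3
    have hvv := (ofNat_inj (by omega) hvw).1 h2
    refine ⟨v', hvv, (hl.adj hadj).1, ?_⟩
    -- An older vertex kept its parent, so its parent would be `u` of level `i`. But an older vertex
    -- other than the root has a parent of level below `i`, and for the root `u` would be the root
    -- itself, adjacent to itself.
    by_contra hne
    have hle : G.dist s v' ≤ i := by
      have := (hl.adj hadj).2
      omega
    rw [hold v' (hl.adj hadj).1 hle] at h3
    by_cases hs : v' = s
    · subst hs
      rw [h.root] at h3
      rw [hinj _ _ h3] at hadj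
      exact hadj.ne rfl
    · obtain ⟨u', h4, h5, h6⟩ := h.parent v' hs (hl.adj hadj).1 hle
      rw [h4] at h3
      rw [hinj _ _ h3, hl.2] at h6
      omega
  -- Among the edges into `v`, the one from its recorded parent won; being processed, it has put `v`
  -- into its slot.
  · intro v hv
    obtain ⟨u, hu, huv, hp⟩ := hnew v hv
    obtain ⟨j, hj, hju⟩ := h.entry_surj u hu
    obtain ⟨e, he, hev⟩ := (csrLists_adj hG).1 huv
    have hx : F.claim C w dense next j u e ∈ F.claims C w dense next := ⟨j, hj, u, hju, e, he, rfl⟩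
    have hxv : (F.claim C w dense next j u e).vertex = .ofNat w v := congrArg (BitVec.ofNat w) hev
    have hs := (hdone _ hx).2 (by rw [hxv]; exact hp)
    obtain ⟨j', hj', u', v', f, hf, hu', -, -, -, hpl, heq, -⟩ := hclaim _ hx
    have hslot_lt : F.place C dense j u e < len := by
      rw [hlen]
      cases hdense : dense with
      | true => exact csrLists_adj_lt hG u.2 he
      | false => exact treeOffset_add_lt (by omega) (by omega) (by rwa [F.leafDeg_eq hju])
    refine ⟨F.place C dense j u e, hslot_lt, ?_⟩
    simp only [Frontier.ofMem]
    rw [show m' (.ofNat w (next + F.place C dense j u e)) = .ofNat w v from hs.trans hxv,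
      if_neg (ofNat_ne_allOnes (by omega)), toNat_ofNat_of_lt (by omega)]
  -- Two slots that hold `v` were filled by claims whose parent is the one recorded for `v`.
  -- Frontier entries and adjacency lists have no repetitions, so the claims, and with them the
  -- slots, coincide.
  · intro j hj j' hj' v hv hv'
    obtain ⟨x, hx, h1, h2, h3⟩ := hentry j hj v hv
    obtain ⟨y, hy, k1, k2, k3⟩ := hentry j' hj' v hv'
    rw [h2] at h3
    rw [k2, h3] at k3
    obtain ⟨a, ha, u, v₁, e, he, hau, -, hue, -, -, rfl, hxp, hxv⟩ := hclaim x hx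
    obtain ⟨b, hb, u', v₂, f, hf, hbu, -, hvf, -, -, rfl, hyp, hyv⟩ := hclaim y hy
    rw [hxp, hyp] at k3
    obtain rfl := hinj _ _ k3
    rw [hxv] at h2
    rw [hyv, ← h2] at k2
    obtain rfl := hinj _ _ k2
    obtain rfl := h.entry_inj a ha b hb u hau hbu
    obtain rfl := csrLists_adj_inj hG u.2 he hf (hue.trans hvf.symm)
    rw [h1] at k1
    change j < len at hj
    change j' < len at hj'
    have := (ofNat_inj (by omega) (by omega)).1 k1
    omega
  · rw [hold s .rfl (by simp), h.root]
  · intro v hv h1 h2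
    by_cases hle : G.dist s v ≤ i
    · rw [hold v h1 hle]
      exact h.parent v hv h1 hle
    · obtain ⟨u, hu, huv, hp⟩ := hnew v ⟨h1, by omega⟩
      exact ⟨u, hp, huv, by rw [hu.2]; omega⟩
  · intro v hv
    have hm := h.unvisited v fun h' => hv ⟨h'.1, by omega⟩
    rcases hparent v with e | ⟨-, u, hu, huv, -⟩
    · rw [e, hm]
    · exact absurd (hu.adj huv) hv

/-! ### Rounds and their amortised cost -/

section Rounds

variable {n w : ℕ} {ω : ℝ} {G : SimpleGraph (Fin n)} {s : Fin n} {large : Mem w}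

theorem WriteRel.eq_of_forall_ne {W : Set (BitVec w × BitVec w)} {m m' : Mem w} {a : BitVec w}
    (h : WriteRel W m m') (ha : ∀ y, (a, y) ∉ W) : m' a = m a :=
  (h a).resolve_right (ha _)

theorem fillWrites_not_mem {base N a : ℕ} (ha : a < 2 ^ w) (hb : base + N < 2 ^ w)
    (h : a < base ∨ base + N ≤ a) (y : BitVec w) :
    (BitVec.ofNat w a, y) ∉ fillWrites w base N := by
  rintro ⟨i, hi, e⟩
  have := (ofNat_inj (by omega) (by omega)).1 (Prod.ext_iff.1 e).1
  omega

/-- The registers of the root thread at the beginning of a round. -/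
structure RootRegs (n len base next : ℕ) (R : Regs w) : Prop where
  r1 : R 1 = .ofNat w n
  r2 : R 2 = .allOnes w
  r3 : R 3 = .ofNat w 1
  r4 : R 4 = .ofNat w base
  r5 : R 5 = .ofNat w next
  r6 : R 6 = .ofNat w (3 * n)
  r7 : R 7 = .ofNat w len
  r8 : R 8 = .ofNat w 1
  r12 : R 12 = .ofNat w 0
  r22 : R 22 = .ofNat w 0

/-- The sum of the degrees of the vertices that are reachable and have distance at least `i`. -/
noncomputable def remaining (G : SimpleGraph (Fin n)) (s : Fin n) (deg : ℕ → ℕ) (i : ℕ) : ℕ :=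
  open Classical in ∑ v : Fin n with G.Reachable s v ∧ i ≤ G.dist s v, deg v

-- The potential drops in each round by exactly the degree sum of the level, which pays for that
-- round and for the length of the next frontier.
open Classical in
theorem remaining_eq (deg : ℕ → ℕ) (i : ℕ) :
    remaining G s deg i = (∑ v : Fin n with AtLevel G s i v, deg v) +
      remaining G s deg (i + 1) := by
  rw [remaining, remaining, ← Finset.sum_union]
  · refine Finset.sum_congr ?_ fun _ _ => rfl
    ext v
    simp only [Finset.mem_filter, Finset.mem_univ, true_and, Finset.mem_union]
    rw [AtLevel, ← and_or_left, and_congr_right_iff]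
    intro _
    omega
  · rw [Finset.disjoint_filter]
    rintro v - ⟨-, h1⟩ ⟨-, h2⟩
    omega

/-- The second part of a round: the next frontier is cleared, the edges are explored, and the
frontiers are exchanged. -/
theorem safe_round (hG : IsCSR G large) (hw : 5 * n < 2 ^ w) {h : ℕ} (hh : n ≤ 2 ^ h)
    {i : ℕ} {F : Frontier} {base next len : ℕ}
    (hbn : base = n ∧ next = 2 * n ∨ base = 2 * n ∧ next = n) {dense : Bool}
    (hd : dense = false → F.degSum (csrLists n large) 1 ≤ n)
    (hlen : len = if dense then n else F.degSum (csrLists n large) 1) (hlen' : 0 < len)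
    {R : Regs w} {t : ℝ} {m : Mem w} (hS : SearchState G s i F m) (hm : F.Stored base m)
    (hT : F.SumsStored (csrLists n large) m) (hR : RootRegs n F.len base next R)
    (h18 : R 18 = .ofNat w len) (h21 : R 21 = denseFlag w dense) {Q : ℝ → Mem w → Prop} {b : ℕ}
    (hQ : ∀ F' R' t' m', t' ≤ t + ((35 * h + 56 : ℕ) : ℝ) → F'.len = len →
      SearchState G s (i + 1) F' m' → F'.Stored next m' → RootRegs n F'.len next base R' →
      Safe (bfsMachine ω large (5 * n)) (.alone w) Q b (.run 16 R' t') m') :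
    Safe (bfsMachine ω large (5 * n)) (.alone w) Q
      (b + 21 * len + 44 * F.len + 28 * F.degSum (csrLists n large) 1 + 27) (.run 29 R t) m := by
  set C := csrLists n large with hCdef
  have hn : n ≤ next := by omega
  have hn' : next ≤ 2 * n := by omega
  have hC : C.Stored large := csrLists_stored hG
  have hCn : C.n = n := rfl
  have hFC : ∀ i < F.len, ∀ u, F.entry i = some u → u < C.n := fun j hj u hu => hS.entry_lt hj hu
  have hE : Claim.Consistent (F.claims C w dense next) := F.claims_consistent hC hw hFC hd hn hn'
  have hlen_le : len ≤ n := by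
    rw [hlen]
    split_ifs with hdense
    · exact le_rfl
    · exact hd (by simpa using hdense)
  have hFl := hS.len_le
  have hn0 : 0 < n := by have := hS.len_pos; omega
  have hR' := hR
  obtain ⟨h1, h2, h3, h4, h5, h6, h7, h8, h12, h22⟩ := hR
  refine .mono (b := 21 * len + (44 * F.len + 28 * F.degSum C 1 + (b + 5) + 10) + 10 + 2) ?_
    (by omega)
  refine .op rfl (.op rfl ?_)
  simp only [ne_eq, not_false_eq_true, Function.update_of_ne, Nat.reduceEqDiff, h5, h18, h22, eval_add, add_zero]
  refine safe_call (pc := 31) (r := WriteRel (fillWrites w next len)) (h₁ := WriteRel.refl)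
    (h₂ := WriteRel.trans) (loop := 47) (P := fun m' => ∀ i < len, m' (.ofNat w (next + i)) =
      .allOnes w) (c := 10 * h + 6) rfl rfl rfl rfl rfl (by omega) ?_
    (safe_fill hlen' (by omega) (by omega) (by omega) (by omega) ?_ ?_ ?_ ?_ ?_) ?_
  · simp [h3]
  · simp [h2]
  · simp [h3]
  · simp [h8]
  · simp
  · simp
  intro t₁ m₁ ht₁ hr₁ hfill
  have hsame : ∀ a, a < 5 * n → a < next ∨ next + n ≤ a → m₁ (.ofNat w a) = m (.ofNat w a) :=
    fun a ha ha' => hr₁.eq_of_forall_ne (fillWrites_not_mem (by omega) (by omega) (by omega))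
  have hS₁ : SearchState G s i F m₁ := hS.congr fun v hv => hsame v (by omega) (by omega)
  have hm₁ : F.Stored base m₁ := fun j hj => by rw [hsame _ (by omega) (by omega), hm j hj]
  have hT₁ : F.SumsStored C m₁ := fun k hk hk' => by
    rw [hsame _ (by omega) (by omega), hT k hk hk']
  refine safe_call (pc := 36) (r := Claim.Rel (F.claims C w dense next)) (h₁ := Claim.Rel.refl)
    (h₂ := Claim.Rel.trans hE) (loop := 88) (P := fun m' => ∀ x ∈ F.claims C w dense next, x.Done m')
    (c := 25 * h + 31) rfl rfl rfl rfl rfl (by omega) ?_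
    (safe_explore (base := base) hC hw hS.len_pos hFl hFC hd hn' (by omega) (by omega) (by omega) hE hh hm₁ hT₁
      ?_ ?_ ?_ ?_ ?_ ?_ ?_ ?_ ?_ ?_) ?_
  · simp [h3]
  · simp [h1, hCn]
  · simp [h2]
  · simp [h3]
  · simp [h4]
  · simp [h5]
  · simp [h6, hCn]
  · simp [h7]
  · simp [h8]
  · simp [h12]
  · simp [h21]
  intro t₂ m₂ ht₂ hr₂ hdone
  refine .op rfl (.op rfl (.op rfl (.op rfl (.jump rfl ?_))))
  refine hQ (Frontier.ofMem m₂ next len) _ _ _ ?_ rfl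
    (hS₁.next hG hw hn hn' hd hlen hlen' hfill hr₂ hdone) (Frontier.ofMem_stored _ _ _) ?_
  · push_cast at *
    linarith
  · constructor <;> simp only [Function.update_self, ne_eq, not_false_eq_true,
      Function.update_of_ne, Nat.reduceEqDiff, h1, h2, h3, h4, h5, h6, h8, h12, h18, h22,
      eval_add, add_zero, Frontier.ofMem]

/-- The rounds from level `i` on. -/
theorem safe_rounds (hG : IsCSR G large) (hw : 5 * n < 2 ^ w) (hw' : 2 * edgeCount G < 2 ^ w)
    {h : ℕ} (hh : n ≤ 2 ^ h) (k : ℕ) {i : ℕ} (hi : diameter G < i + k) {F : Frontier}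
    {base next : ℕ} (hbn : base = n ∧ next = 2 * n ∨ base = 2 * n ∧ next = n) {R : Regs w} {t : ℝ} {m : Mem w} (hS : SearchState G s i F m)
    (hm : F.Stored base m) (hR : RootRegs n F.len base next R) :
    Safe (bfsMachine ω large (5 * n)) (.alone w)
      (fun t' m' => t' ≤ t + (((k + 1) * (53 * h + 100) : ℕ) : ℝ) ∧ IsBFSTree G s m')
      (82 * F.len + 200 * remaining G s (csrLists n large).deg i + 60) (.run 16 R t) m := by
  classical
  induction k using Nat.strong_induction_on generalizing i F base next R t m with
  | _ k ih =>
  set C := csrLists n large with hCdef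
  have hC : C.Stored large := csrLists_stored hG
  have hCn : C.n = n := rfl
  have hFC : ∀ i < F.len, ∀ u, F.entry i = some u → u < C.n := fun j hj u hu => hS.entry_lt hj hu
  have hFl := hS.len_le
  have hF0 := hS.len_pos
  have hD := hS.degSum_one C
  -- The degree sum is at most `2 * m`, so it fits into a word and its comparisons with `0` and `n`
  -- are faithful.
  have hDw : F.degSum C 1 < 2 ^ w := by
    refine lt_of_le_of_lt ?_ hw'
    rw [hD, ← sum_deg hG]
    exact Finset.sum_le_sum_of_subset (Finset.filter_subset _ _)
  have hrem := remaining_eq (G := G) (s := s) C.deg i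
  rw [← hD] at hrem
  set D := F.degSum C 1 with hDdef
  have hR' := hR
  obtain ⟨h1, h2, h3, h4, h5, h6, h7, h8, h12, h22⟩ := hR
  refine .mono (b := 38 * F.len + (44 * F.len + 200 * remaining G s C.deg i + 50) + 10) ?_ (by omega)
  refine safe_call (pc := 16) (r := WriteRel (F.sumWrites C w)) (h₁ := WriteRel.refl)
    (h₂ := WriteRel.trans) (loop := 59) (P := F.SumsStored C) (c := 18 * h + 15)
    rfl rfl rfl rfl rfl (by omega) h3
    (safe_sums (base := base) hC hw hF0 hFl hFC (by omega) (by omega) hm ?_ ?_ ?_ ?_ ?_ ?_) ?_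
  · simp [h2]
  · simp [h3]
  · simp [h4]
  · simp [h6, hCn]
  · simp [h7]
  · simp [h8]
  intro t₁ m₁ ht₁ hr₁ hT
  have hsame : ∀ a, a < 3 * n → m₁ (.ofNat w a) = m (.ofNat w a) := fun a ha =>
    hr₁.eq_of_forall_ne (by
      rintro y ⟨k, hk, hk', e⟩
      have := (ofNat_inj (by omega) (by omega)).1 (Prod.ext_iff.1 e).1
      omega)
  have hS₁ : SearchState G s i F m₁ := hS.congr fun v hv => hsame v (by omega)
  have hm₁ : F.Stored base m₁ := fun j hj => by rw [hsame _ (by omega), hm j hj]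
  have hT1 := hT 1 one_pos (by omega)
  rw [hCn] at hT1
  have hload : ∀ {Q b}, (∀ R' : Regs w, (∀ r, r ≠ 9 → r ≠ 10 → r ≠ 17 → R' r = R r) →
      R' 17 = .ofNat w D → Safe (bfsMachine ω large (5 * n)) (.alone w) Q b
        (.run 23 R' (t₁ + 1 + 1)) m₁) →
      Safe (bfsMachine ω large (5 * n)) (.alone w) Q (b + 1 + 1)
        (.run 21 (Function.update R 9 0) t₁) m₁ := by
    intro Q b hQ
    refine .op rfl ?_
    simp only [ne_eq, not_false_eq_true, Function.update_of_ne, Nat.reduceEqDiff, h6, h3, eval_add]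
    refine .loadSmall rfl ?_ ?_
    · rw [Function.update_self, toNat_ofNat_of_lt (by omega)]
      change _ < 5 * n
      omega
    · rintro _ rfl
      refine hQ _ (fun r h9 h10 h17 => ?_) ?_
      · simp [h9, h10, h17]
      · rw [Function.update_self, Function.update_self, hT1]
  by_cases hD0 : D = 0
  · refine (hload (b := 48) fun R' hR'' h17 => .jumpZero_taken rfl (by rw [h17, hD0]; rfl)
      (.halt rfl ?_)).mono (by omega)
    rintro _ rfl
    refine ⟨?_, hS₁.isBFSTree hw fun u v hu huv => ?_⟩
    · have : (0 : ℝ) ≤ (k : ℝ) * (53 * h + 100) := by positivity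
      push_cast at *
      linarith
    · rw [hD, Finset.sum_eq_zero_iff] at hD0
      have : (csrLists n large).deg u = 0 := hD0 u (by simpa using hu)
      obtain ⟨e, he, -⟩ := (csrLists_adj hG).1 huv
      omega
  -- A positive degree sum shows that level `i` is inhabited, so `i` is at most the diameter and a
  -- further round is available. A frontier that consists of holes only has sum zero and has already
  -- stopped the search.
  · obtain ⟨v, hv⟩ : ∃ v, AtLevel G s i v := by
      by_contra hne
      push Not at hne
      exact hD0 (by rw [hD, Finset.filter_false_of_mem fun v _ => hne v, Finset.sum_empty])
    have hk := hv.le_diameter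
    obtain ⟨k, rfl⟩ : ∃ k', k = k' + 1 := ⟨k - 1, by omega⟩
    let dense : Bool := decide (n < D)
    have hd : dense = false → D ≤ n := by simp [dense]
    let len := if dense then n else D
    have hlen' : 0 < len := by
      simp only [len]
      split_ifs <;> omega
    have hlenD : len ≤ D := by
      simp only [len, dense, decide_eq_true_eq]
      split_ifs <;> omega
    have hround : ∀ (R' : Regs w) (t' : ℝ), t' ≤ t₁ + 7 →
        (∀ r, r ≠ 9 → r ≠ 10 → r ≠ 17 → r ≠ 18 → r ≠ 21 → R' r = R r) → R' 18 = .ofNat w len →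
        R' 21 = denseFlag w dense → Safe (bfsMachine ω large (5 * n)) (.alone w)
          (fun t' m' => t' ≤ t + (((k + 1 + 1) * (53 * h + 100) : ℕ) : ℝ) ∧ IsBFSTree G s m')
          (44 * F.len + 200 * remaining G s C.deg i + 50 - 7) (.run 29 R' t') m₁ := by
      intro R' t' ht' hRR h18 h21
      refine (safe_round (len := len) hG hw hh hbn hd rfl hlen' hS₁ hm₁ hT ?_ h18 h21 (b := 82 * len +
        200 * remaining G s C.deg (i + 1) + 60) fun F' R'' t'' m'' ht'' hF' hS'' hm'' hR'' => ?_).mono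
        ?_
      · constructor <;> rw [hRR _ (by decide) (by decide) (by decide) (by decide) (by decide)] <;>
          assumption
      · rw [← hF']
        refine (ih k (by omega) (by omega) (by omega) hS'' hm'' hR'').weaken
          fun t₃ m₃ ht₃ => ⟨?_, ht₃.2⟩
        have := ht₃.1
        push_cast at *
        linarith
      -- The sums and the exploration cost `38 + 44 = 82` per entry of the current frontier. The
      -- next frontier costs `21 + 82` per entry with `len ≤ D`, the edges cost `28 * D`, and the
      -- constants are at most `44 * D` as `D ≥ 1`: together below the `200 * D` released by the
      -- potential.
      · have : F.degSum (csrLists n large) 1 = D := rfl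
        omega
    rw [show 44 * F.len + 200 * remaining G s C.deg i + 50 =
      44 * F.len + 200 * remaining G s C.deg i + 50 - 7 + 1 + 1 + 1 + 1 + 1 + 1 + 1 by omega]
    refine hload fun R' hRR h17 => .jumpZero_not_taken rfl ?_ (.op rfl ?_)
    · rw [h17]
      exact ofNat_ne_zero (by omega) hDw
    have h1' := hRR 1 (by decide) (by decide) (by decide)
    have h22' := hRR 22 (by decide) (by decide) (by decide)
    rw [h1] at h1'
    rw [h22] at h22'
    by_cases hdense : n < D
    · rw [h1', h17, eval_lt_of_lt hdense hDw]
      refine .jumpZero_not_taken rfl ?_ (.op rfl (.jump rfl (hround _ _ (by linarith) ?_ ?_ ?_)))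
      · rw [Function.update_self]
        exact ofNat_ne_zero one_pos (show 1 < 2 ^ w by omega)
      · intro r _ _ _ _ _
        simp [*]
      · simp [h1', h22', eval_add, len, dense, hdense]
      · simp [denseFlag, dense, hdense]
    · rw [h1', h17, eval_lt_of_le (not_lt.1 hdense) (by omega)]
      refine .jumpZero_taken rfl ?_ ((Safe.op rfl (hround _ _ (by linarith) ?_ ?_ ?_)).mono
        (Nat.le_succ _))
      · rw [Function.update_self]
        rfl
      · intro r _ _ _ _ _
        simp [*]
      · simp [h17, h22', eval_add, len, dense, hdense]
      · simp [denseFlag, dense, hdense]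

end Rounds

/-! ### Initialisation and total cost -/

section Main

variable {n w : ℕ} {ω : ℝ} {G : SimpleGraph (Fin n)} {s : Fin n} {large : Mem w}

theorem searchState_init (hw : 5 * n < 2 ^ w) {m : Mem w}
    (hfill : ∀ i < n, m (.ofNat w i) = .allOnes w) :
    let m' := Function.update (Function.update m (.ofNat w s) (.ofNat w s)) (.ofNat w n) (.ofNat w s)
    SearchState G s 0 ⟨1, fun _ => some (s : ℕ)⟩ m' ∧
      (⟨1, fun _ => some (s : ℕ)⟩ : Frontier).Stored n m' := by
  intro m'
  have hm' : ∀ v : Fin n, m' (.ofNat w v) = if v = s then .ofNat w s else .allOnes w := by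
    intro v
    have hvn : BitVec.ofNat w v ≠ .ofNat w n := fun e => by
      have := (ofNat_inj (by omega) (by omega)).1 e
      omega
    simp only [m', Function.update_of_ne hvn]
    split_ifs with hv
    · rw [hv, Function.update_self]
    · rw [Function.update_of_ne, hfill v v.2]
      exact fun e => hv (Fin.ext ((ofNat_inj (by omega) (by omega)).1 e))
  refine ⟨⟨one_pos, s.pos, ?_, ?_, ?_, ?_, ?_, ?_⟩, ?_⟩
  · intro j _ u hu
    exact ⟨s, Option.some_inj.1 hu, atLevel_zero.2 rfl⟩
  · intro v hv
    exact ⟨0, one_pos, by rw [atLevel_zero.1 hv]⟩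
  · intro j hj j' hj' _ _ _
    simp only at hj hj'
    omega
  · rw [hm', if_pos rfl]
  · intro v hv h1 h2
    exact absurd (atLevel_zero.1 ⟨h1, by omega⟩) hv
  · intro v hv
    rw [hm', if_neg]
    rintro rfl
    exact hv ⟨.rfl, by simp⟩
  · intro j hj
    obtain rfl : j = 0 := by simp only at hj; omega
    simp [m', Frontier.encode]

theorem remaining_zero_le (hG : IsCSR G large) :
    remaining G s (csrLists n large).deg 0 ≤ 2 * edgeCount G := by
  classical
  rw [← sum_deg hG, remaining]
  exact Finset.sum_le_sum_of_subset (Finset.filter_subset _ _)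

theorem safe_bfs (hG : IsCSR G large) (hw : 5 * n < 2 ^ w) (hw' : 2 * edgeCount G < 2 ^ w)
    {h : ℕ} (hh : n ≤ 2 ^ h) (m : Mem w) :
    Safe (bfsMachine ω large (5 * n)) (.alone w)
      (fun t' m' => t' ≤ (((diameter G + 3) * (53 * h + 100) : ℕ) : ℝ) ∧ IsBFSTree G s m')
      (21 * n + 400 * edgeCount G + 200)
      (.run 0 (Function.update (fun _ => 0) 0 (.ofNat w s)) 0) m := by
  have hn0 : 0 < n := s.pos
  have hC := csrLists_stored hG
  have hsize : large (.ofNat w 0) = .ofNat w n := hC.size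
  have hrem := remaining_zero_le (s := s) hG
  refine .mono (b := 21 * n + (400 * edgeCount G + 150) + 10 + 8) ?_ (by omega)
  refine .const rfl (.op rfl (.loadLarge rfl (.op rfl (.op rfl (.op rfl (.op rfl (.const rfl ?_)))))))
  have e0 : (0 : BitVec w) = .ofNat w 0 := rfl
  have hmax : BinOp.sub.eval (BitVec.ofNat w 0) (.ofNat w 1) = .allOnes w := by
    simp [BinOp.eval, BitVec.neg_one_eq_allOnes]
  simp only [Function.update_self, ne_eq, not_false_eq_true, Function.update_of_ne,
    Nat.reduceEqDiff, e0, bfsMachine, hsize, eval_add, add_zero, hmax, OfNat.ofNat_ne_zero]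
  set R : Regs w := Function.update _ 8 _ with hRdef
  have h0 : R 0 = .ofNat w s := by simp [hRdef]
  have h1 : R 1 = .ofNat w n := by simp [hRdef]
  have h2 : R 2 = .allOnes w := by simp [hRdef]
  have h3 : R 3 = .ofNat w 1 := by simp [hRdef]
  have h4 : R 4 = .ofNat w n := by simp [hRdef]
  have h5 : R 5 = .ofNat w (2 * n) := by simp [hRdef, two_mul]
  have h6 : R 6 = .ofNat w (3 * n) := by simp [hRdef, show 3 * n = n + n + n by ring]
  have h8 : R 8 = .ofNat w 1 := by simp [hRdef]
  have h12 : R 12 = .ofNat w 0 := by simp [hRdef]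
  have h19 : R 19 = .ofNat w 0 := by simp [hRdef]
  have h20 : R 20 = .ofNat w n := by simp [hRdef]
  have h22 : R 22 = .ofNat w 0 := by simp [hRdef]
  clear hRdef
  clear_value R
  refine safe_call (ω := ω) (large := large) (sp := 5 * n) (pc := 8)
    (r := WriteRel (fillWrites w 0 n)) (h₁ := WriteRel.refl) (h₂ := WriteRel.trans) (loop := 47)
    (P := fun m' => ∀ i < n, m' (.ofNat w (0 + i)) = .allOnes w) (c := 10 * h + 6)
    rfl rfl rfl rfl rfl (by omega) h3
    (safe_fill hn0 (by omega) (by omega) (by omega) hh ?_ ?_ ?_ ?_ ?_) ?_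
  · simp [h2]
  · simp [h3]
  · simp [h8]
  · simp [h19]
  · simp [h20]
  intro t₁ m₁ ht₁ _ hfill
  simp only [zero_add] at hfill
  obtain ⟨hS, hF⟩ := searchState_init (s := s) (G := G) hw hfill
  refine .mono (b := 82 * 1 + 200 * remaining G s (csrLists n large).deg 0 + 60 + 3) ?_ (by omega)
  refine .storeSmall rfl ?_ ?_
  · rw [Function.update_of_ne (by decide), h0, toNat_ofNat_of_lt (by omega)]
    change _ < 5 * n
    omega
  rintro _ rfl
  refine ⟨trivial, .storeSmall rfl ?_ ?_⟩
  · rw [Function.update_of_ne (by decide), h4, toNat_ofNat_of_lt (by omega)]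
    change _ < 5 * n
    omega
  rintro _ rfl
  refine ⟨trivial, .const rfl ?_⟩
  simp only [ne_eq, not_false_eq_true, Function.update_of_ne, Nat.reduceEqDiff, h0, h4,
    OfNat.zero_ne_ofNat]
  -- The rounds take depth at most `(diameter G + 2) * (53 * h + 100)`; initialisation fits into one
  -- more factor `53 * h + 100`.
  refine (safe_rounds (base := n) (next := 2 * n) hG hw hw' hh (diameter G + 1) (by omega)
    (.inl ⟨rfl, rfl⟩) hS hF ?_).weaken fun t' m' ht' => ⟨?_, ht'.2⟩
  · constructor <;> simp [*]
  · have := ht'.1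
    push_cast at *
    linarith

end Main

end PSAM

theorem mainTheorem2 :
    ∃ (prog : PSAM.Program) (Cword Cdepth Cspace : ℕ),
      ∀ κ : ℝ, 0 < κ → ∃ Cwork : ℕ,
        ∀ (ω : ℝ) (_ : 1 < ω) (n w : ℕ) (G : SimpleGraph (Fin n)) (s : Fin n)
          (_ : (n : ℝ) ≤ κ * PSAM.edgeCount G)
          (_ : Cword * (n + PSAM.edgeCount G) ≤ 2 ^ w)
          (small large : BitVec w → BitVec w) (_ : PSAM.IsCSR G large),
          PSAM.Guarantees ω prog
            (fun depth σ =>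
              PSAM.IsBFSTree G s σ.small ∧
              σ.work ≤ Cwork * PSAM.edgeCount G ∧
              depth ≤ Cdepth * (PSAM.diameter G * Real.log n) ∧
              σ.space ≤ Cspace * n)
            (PSAM.initial (BitVec.ofNat w s) small large) := by
  -- The word size must give `5 * n < 2 ^ w` and `2 * m < 2 ^ w`. The work `21 * n + 400 * m + 200`
  -- is bounded using `n ≤ ⌈κ⌉₊ * m` and `1 ≤ m`, and the depth constant comes from `4 * 153 * 3 =
  -- 1836`.
  refine ⟨PSAM.bfs, 6, 2000, 5, fun κ hκ => ⟨21 * ⌈κ⌉₊ + 600, ?_⟩⟩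
  intro ω _ n w G s hm hword small large hG
  have hn0 : 0 < n := s.pos
  -- An edge exists because `0 < n ≤ κ * m`. Hence the diameter and the logarithm of `n` are
  -- positive and absorb the additive constants.
  have hm0 : 0 < PSAM.edgeCount G := by
    by_contra h
    obtain h : PSAM.edgeCount G = 0 := by omega
    rw [h, Nat.cast_zero, mul_zero] at hm
    exact absurd hm (by push Not; exact_mod_cast hn0)
  obtain ⟨e, he⟩ : G.edgeSet.Nonempty :=
    Set.nonempty_of_ncard_ne_zero (s := G.edgeSet) (by unfold PSAM.edgeCount at hm0; omega)
  induction e with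
  | _ a b =>
  have hab : G.Adj a b := he
  have hd : 1 ≤ PSAM.diameter G := by
    rw [← SimpleGraph.dist_eq_one_iff_adj.2 hab]
    exact Finset.le_sup (f := fun p : Fin n × Fin n => G.dist p.1 p.2) (Finset.mem_univ (a, b))
  have hn2 : 2 ≤ n := by
    by_contra h
    exact hab.ne (Fin.ext (by omega))
  have key := (PSAM.safe_bfs (ω := ω) (s := s) hG (by omega) (by omega)
    (Nat.le_pow_clog one_lt_two n) small).guarantees (wk := 0) (sp := 0) (Nat.zero_le _)
  refine key.mono fun t σ hσ => ?_
  obtain ⟨⟨h1, h2⟩, h3, h4⟩ := hσ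
  refine ⟨h2, h3.trans ?_, h1.trans ?_, h4⟩
  · have hκ' := Nat.le_ceil κ
    have hm1 : (1 : ℝ) ≤ PSAM.edgeCount G := by exact_mod_cast hm0
    have : (n : ℝ) ≤ ⌈κ⌉₊ * PSAM.edgeCount G := hm.trans (by gcongr)
    push_cast
    nlinarith
  -- From `2 ^ (clog - 1) ≤ n` and `2 ≤ n` one gets `clog * log 2 ≤ 2 * log n`, and `2 / log 2 < 3`.
  · have hlog : (Nat.clog 2 n : ℝ) ≤ 3 * Real.log n := by
      have h1 : (2 : ℝ) ^ (Nat.clog 2 n - 1) ≤ n := by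
        exact_mod_cast (Nat.pow_pred_clog_lt_self one_lt_two hn2).le
      have h2 := Real.log_le_log (by positivity) h1
      rw [Real.log_pow, Nat.cast_sub (Nat.clog_pos one_lt_two hn2), Nat.cast_one] at h2
      have h3 : Real.log 2 ≤ Real.log n := Real.log_le_log two_pos (by exact_mod_cast hn2)
      nlinarith [Real.log_two_gt_d9]
    have hclog : (1 : ℝ) ≤ Nat.clog 2 n := by
      exact_mod_cast Nat.clog_pos one_lt_two hn2
    have hd' : (1 : ℝ) ≤ PSAM.diameter G := by exact_mod_cast hd
    push_cast
    calc ((PSAM.diameter G : ℝ) + 3) * (53 * Nat.clog 2 n + 100)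
        ≤ (4 * PSAM.diameter G) * (153 * Nat.clog 2 n) := by
          gcongr <;> linarith
      _ ≤ (4 * PSAM.diameter G) * (153 * (3 * Real.log n)) := by gcongr
      _ ≤ 2000 * (PSAM.diameter G * Real.log n) := by
          have : 0 ≤ (PSAM.diameter G : ℝ) * Real.log n := by positivity
          linarith
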